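/- **Setting.** Let $2\le k<n$, let $\theta_1\ge\dots\ge\theta_k>\theta_{k+1}\ge\dots\ge\theta_n>0$ be the parameters of a multinomial logit (MNL) model on the items $[n]=\{1,\dots,n\}$, and let $\Delta_{(k)}=\theta_k-\theta_{k+1}$ and $p_{ij}=\theta_i/(\theta_i+\theta_j)$. In round $t$ a learner plays a set $S_t$ of $k$ items and receives a ranking of $S_t$, obtained by successively drawing items from $S_t$ without replacement, each time with probabilities proportional to the $\theta_i$ of the items that are left. The Top-$k$-regret is $R_T^k=\sum_{t=1}^T\frac1k\big(\sum_{i=1}^k\theta_i-\sum_{i\in S_t}\theta_i\big)$. **Algorithm (Rec-MaxMin-UCB, parameter $\alpha>\frac12$).** Let $w_{ij}$ be the number of earlier rounds in which $i$ and $j$ were both played and $i$ was ranked before $j$; let $n_{ij}=w_{ij}+w_{ji}$, and in round $t$ let $u_{ij}=\frac{w_{ij}}{n_{ij}}+\sqrt{\alpha\ln t/n_{ij}}$ for $i\ne j$ ($u_{ij}=\infty$ if $n_{ij}=0$) and $u_{ii}=\frac12$. For $I\subseteq[n]$ let $C(I)=\{i\in I: u_{ij}>\frac12\ \forall j\in I\setminus\{i\}\}$,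 and let $C'(I)=C(I)$ if this is non-empty and $C'(I)=I$ otherwise. *Building $\ell$ items from a pool $I$ onto a set $S$* means: while $|C'(I)|<\ell$, move $C'(I)$ from $I$ to $S$ and lower $\ell$ by the number of items moved; then add, $\ell$ times, an item $a\in I\setminus S$ that maximizes $\min_{i\in S}u_{ai}$ (any item of $C'(I)$ if $S=\emptyset$). The algorithm keeps slots $B(1),\dots,B(k)$, each empty or holding one item, all empty at the start. In each round it starts with $S=\emptyset$, $I=[n]$, and for $h=1,\dots,k-1$: if $B(h)$ holds an item of $C(I)$, this item is moved from $I$ to $S$. Otherwise $B(h)$ is emptied; if $C(I)\neq\emptyset$, one item is built from $I$ onto $S$, is put into $B(h)$ and is removed from $I$; then $k-|S|$ further items are built from $I$ onto $S$, the loop ends, and $S$ is played (the slots after $h$ are kept or emptied). If the loop has run through all $h\le k-1$: if $C(I)=\{i\}$ is a singleton, $i$ is put into $B(k)$ and added to $S$; otherwise $B(k)$ is emptied unless it holds an item of $C(I)$, and one item is built from $I$ onto $S$; then $S$ is played. Choices left open, such as ties, may be made in any way, at random or depending on the past. **Constants.** Let $$f(\delta)=\Big[\frac{2\alpha n^2}{(2\alpha-1)\delta}\Big]^{\frac1{2\alpha-1}},\qquad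 \Delta'_{\max}=\frac1k\Big(\sum_{i=1}^k\theta_i-\sum_{i=n-k+1}^n\theta_i\Big).$$ For $g\in[k]$ let $Z(g)=\{j\in[n]:\theta_j<\theta_g\}$, and for $i\in[n]$ and $j\in Z(g)$, $i\ne j$, let $$D^g_{ij}=\begin{cases}\dfrac{4\alpha}{(p_{gj}-\frac12)^2}&\text{if }\theta_i=\theta_g,\\[2mm] \dfrac{4\alpha}{(p_{gi}-p_{ji})^2}&\text{if }\theta_i>\theta_g,\\[2mm] \dfrac{4\alpha}{\min\{(p_{gi}-\frac12)^2,(p_{gj}-\frac12)^2\}}&\text{if }\theta_i<\theta_g.\end{cases}$$ Let $D^{(g)}=\sum_{j\in Z(g)}\sum_{i<j}D^g_{ij}$ and $\bar D^{(k)}=\sum_{g=1}^kD^{(g)}$. For $b>k$ let $\hat D_b=\min_{g\in[k-1]}(p_{kg}-p_{bg})$. **Theorem.** For every $T\in\mathbb N$ and $\delta\in(0,1)$, with probability at least $1-\delta$ the Top-$k$-regret of Rec-MaxMin-UCB satisfies $$R_T^k\le\Big(2f(\delta)+2\bar D^{(k)}\ln\big(2\bar D^{(k)}\big)\Big)\Delta'_{\max}+\frac{4\alpha\ln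 T}{k}\sum_{b=k+1}^n\frac{\theta_k-\theta_b}{\hat D_b^2}.$$ Moreover, the last term is $O\big(\frac{(n-k)\ln T}{k\,\Delta_{(k)}}\big)$; more precisely, it is at most $64\,\alpha\,\theta_1^2\,\frac{(n-k)\ln T}{k\,\Delta_{(k)}}$. -/

import Mathlib

open scoped ENNReal

noncomputable section

open Classical in
/-- The multinomial logit choice from a non-empty set `S`: item `i ∈ S` is chosen with probability
`θ i / ∑ j ∈ S, θ j`. -/
def mnlChoice {n : ℕ} (θ : Fin n → ℝ) (hθ : ∀ i, 0 < θ i) (S : Finset (Fin n))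
    (hS : S.Nonempty) : PMF (Fin n) :=
  PMF.ofFinset (fun i => if i ∈ S then ENNReal.ofReal (θ i / ∑ j ∈ S, θ j) else 0) S
    (by
      have hsum : 0 < ∑ j ∈ S, θ j := Finset.sum_pos (fun i _ => hθ i) hS
      rw [Finset.sum_congr rfl (fun i hi => if_pos hi), ← ENNReal.ofReal_sum_of_nonneg
        (fun i _ => (div_pos (hθ i) hsum).le), ← Finset.sum_div, div_self hsum.ne']
      exact ENNReal.ofReal_one)
    (fun _ hi => if_neg hi)

open Classical in
/-- Top-`m`-ranking feedback from `S`: `m` successive multinomial logit choices without replacement,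
listed in the order in which they are drawn (the whole of `S` is ranked if it has at most `m`
items). -/
def topRanking {n : ℕ} (θ : Fin n → ℝ) (hθ : ∀ i, 0 < θ i) :
    ℕ → Finset (Fin n) → PMF (List (Fin n))
  | 0, _ => PMF.pure []
  | m + 1, S =>
      if hS : S.Nonempty then
        (mnlChoice θ hθ S hS).bind fun i =>
          (topRanking θ hθ m (S.erase i)).map fun σ => i :: σ
      else PMF.pure []

/-- The pairwise preference `p i j = Pr(i | {i, j})`. -/
def pref {n : ℕ} (θ : Fin n → ℝ) (i j : Fin n) : ℝ := θ i / (θ i + θ j)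

/-- What happens in one round: the slots `B_t(1), …, B_t(k)` (each of them empty or holding one
item), the set `S_t` played, and the ranking `σ_t` received. -/
structure Round (n k : ℕ) where
  slots : Fin k → Option (Fin n)
  played : Finset (Fin n)
  ranking : List (Fin n)

/-- The rounds played so far, the most recent one first. -/
abbrev History (n k : ℕ) := List (Round n k)

/-- Rank-breaking: `i` beats `j` in the round if `i` is ranked, and `j` is an item of the played set
that is not among the items ranked up to and including `i`. -/
def Round.Beats {n k : ℕ} (r : Round n k) (i j : Fin n) : Prop :=
  i ∈ r.ranking ∧ j ∈ r.played ∧ r.ranking.idxOf i < r.ranking.idxOf j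

open Classical in
/-- The matrix `W`: the number of rounds in which `i` has beaten `j`. -/
def wins {n k : ℕ} (h : History n k) (i j : Fin n) : ℕ :=
  h.countP fun r => decide (r.Beats i j)

/-- The slots `B_{t-1}` left by the last round; all of them are empty at the start. -/
def lastSlots {n k : ℕ} : History n k → Fin k → Option (Fin n)
  | [] => fun _ => none
  | r :: _ => r.slots

/-- The upper confidence bounds `u_ij` of round `t`, from the matrix `W`. A pair that has never been
compared has the bound `∞`. -/
def ucb {n : ℕ} (α : ℝ) (t : ℕ) (W : Fin n → Fin n → ℕ) (i j : Fin n) : EReal :=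
  if i = j then ((1 / 2 : ℝ) : EReal)
  else if W i j + W j i = 0 then ⊤
  else (((W i j : ℝ) / ((W i j + W j i : ℕ) : ℝ)
    + √(α * Real.log t / ((W i j + W j i : ℕ) : ℝ)) : ℝ) : EReal)

open Classical in
/-- The potential Condorcet winners of the pool `I`: the items `i ∈ I` with `u_ij > 1/2` for all
`j ∈ I \ {i}`. -/
def condorcet {n : ℕ} (U : Fin n → Fin n → EReal) (I : Finset (Fin n)) : Finset (Fin n) :=
  {i ∈ I | ∀ j ∈ I, j ≠ i → ((1 / 2 : ℝ) : EReal) < U i j}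

open Classical in
/-- The candidates in the pool `I`: its potential Condorcet winners, or all of `I` if there are
none. -/
def candidates {n : ℕ} (U : Fin n → Fin n → EReal) (I : Finset (Fin n)) : Finset (Fin n) :=
  if condorcet U I = ∅ then I else condorcet U I

open Classical in
/-- `MaxMinFill U C I ℓ S R`: the set `R` can arise from `S` by adding, `ℓ` times, an item `a` of
`I \ S` that maximizes `min_{i ∈ S} u_{ai}`, ties being broken arbitrarily. When `S` is still empty
the criterion is void, and any item of `C` can be taken. -/
inductive MaxMinFill {n : ℕ} (U : Fin n → Fin n → EReal) (C I : Finset (Fin n)) :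
    ℕ → Finset (Fin n) → Finset (Fin n) → Prop
  | done (S : Finset (Fin n)) : MaxMinFill U C I 0 S S
  | pick (ℓ : ℕ) (S R : Finset (Fin n)) (a : Fin n)
      (ha : a ∈ I \ S) (hC : S = ∅ → a ∈ C)
      (hmax : ∀ c ∈ I \ S, S.inf (U c) ≤ S.inf (U a))
      (hR : MaxMinFill U C I ℓ (insert a S) R) :
      MaxMinFill U C I (ℓ + 1) S R

open Classical in
/-- `BuildS U S I ℓ R`: the set `R` can arise from `S` when the set-building rule adds `ℓ` items of
the pool `I` to `S`. As long as fewer than `ℓ` items are candidates, all of them are moved from the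
pool to the set; the remaining items are picked by the max-min rule. -/
inductive BuildS {n : ℕ} (U : Fin n → Fin n → EReal) :
    Finset (Fin n) → Finset (Fin n) → ℕ → Finset (Fin n) → Prop
  | all (S I : Finset (Fin n)) (ℓ : ℕ) (R : Finset (Fin n))
      (hcard : (candidates U I).card < ℓ)
      (hR : BuildS U (S ∪ candidates U I) (I \ candidates U I) (ℓ - (candidates U I).card) R) :
      BuildS U S I ℓ R
  | fill (S I : Finset (Fin n)) (ℓ : ℕ) (R : Finset (Fin n))
      (hcard : ℓ ≤ (candidates U I).card)
      (hR : MaxMinFill U (candidates U I) I ℓ S R) :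
      BuildS U S I ℓ R

open Classical in
/-- `SelectSet U B' B h I S R`: with upper confidence bounds `U` and the slots `B'` of the previous
round, the algorithm, having arrived at slot `h` with the pool `I` of items that are left and the
set `S` that is built so far, can assign the slots from `h` on as in `B` and play the set `R`.
The slots are numbered from `0` to `k - 1`. Slots that are not reached in a round are not
assigned; they may be kept as they are, or be cleared. -/
inductive SelectSet {n k : ℕ} (U : Fin n → Fin n → EReal) (B' B : Fin k → Option (Fin n)) :
    Fin k → Finset (Fin n) → Finset (Fin n) → Finset (Fin n) → Prop
  /-- The item of slot `h` is still a potential winner of the pool: it stays, and is played. -/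
  | keep (h h' : Fin k) (I S R : Finset (Fin n)) (i : Fin n)
      (hh : (h' : ℕ) = h + 1)
      (hi : B' h = some i) (hiC : i ∈ condorcet U I) (hB : B h = some i)
      (hR : SelectSet U B' B h' (I.erase i) (insert i S) R) :
      SelectSet U B' B h I S R
  /-- Slot `h` gets empty, and there are potential winners: a new item enters the slot and is
  played, and the set is filled up to `k` items. -/
  | refill (h : Fin k) (I S R : Finset (Fin n)) (x : Fin n)
      (hh : (h : ℕ) + 1 < k)
      (hold : ∀ i, B' h = some i → i ∉ condorcet U I) (hC : (condorcet U I).Nonempty)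
      (hxI : x ∈ I) (hx : BuildS U S I 1 (insert x S)) (hB : B h = some x)
      (hrest : ∀ h', h < h' → B h' = B' h' ∨ B h' = none)
      (hR : BuildS U (insert x S) (I.erase x) (k - (insert x S).card) R) :
      SelectSet U B' B h I S R
  /-- There are no potential winners: slot `h` is empty, and the set is filled up to `k` items. -/
  | restart (h : Fin k) (I S R : Finset (Fin n))
      (hh : (h : ℕ) + 1 < k)
      (hC : condorcet U I = ∅) (hB : B h = none)
      (hrest : ∀ h', h < h' → B h' = B' h' ∨ B h' = none)
      (hR : BuildS U S I (k - S.card) R) :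
      SelectSet U B' B h I S R
  /-- The last slot, if there is exactly one potential winner. -/
  | lastUnique (h : Fin k) (I S : Finset (Fin n)) (i : Fin n)
      (hh : (h : ℕ) + 1 = k)
      (hC : condorcet U I = {i}) (hB : B h = some i) :
      SelectSet U B' B h I S (insert i S)
  /-- The last slot, otherwise. -/
  | lastOther (h : Fin k) (I S R : Finset (Fin n))
      (hh : (h : ℕ) + 1 = k)
      (hC : (condorcet U I).card ≠ 1)
      (hB : B h = (B' h).filter fun i => decide (i ∈ condorcet U I))
      (hR : BuildS U S I 1 R) :
      SelectSet U B' B h I S R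

/-- After the history `h`, the algorithm with exploration parameter `α` can set its slots to `B` and
play the set `S` in round `t = |h| + 1`. -/
def LegalMove {n k : ℕ} (α : ℝ) (h : History n k) (B : Fin k → Option (Fin n))
    (S : Finset (Fin n)) : Prop :=
  ∃ h₀ : Fin k, (h₀ : ℕ) = 0 ∧
    SelectSet (ucb α (h.length + 1) (wins h)) (lastSlots h) B h₀ Finset.univ ∅ S

/-- A decision rule: given the history, a (possibly random) choice of slots and set to play. -/
abbrev Rule (n k : ℕ) := History n k → PMF ((Fin k → Option (Fin n)) × Finset (Fin n))

/-- The rule is an implementation of Rec-MaxMin-UCB with parameter `α`: the choices that the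
algorithm leaves open may be made in any way, at random or depending on the past. -/
def IsRecMaxMinUCB {n k : ℕ} (α : ℝ) (rule : Rule n k) : Prop :=
  ∀ h, ∀ m ∈ (rule h).support, LegalMove α h m.1 m.2

/-- The law of the history of the first `T` rounds, when sets are played by the rule and
top-`k`-ranking feedback is received. -/
def runLaw {n k : ℕ} (θ : Fin n → ℝ) (hθ : ∀ i, 0 < θ i) (rule : Rule n k) :
    ℕ → PMF (History n k)
  | 0 => PMF.pure []
  | T + 1 =>
      (runLaw θ hθ rule T).bind fun h =>
        (rule h).bind fun m =>
          (topRanking θ hθ k m.2).map fun σ => ⟨m.1, m.2, σ⟩ :: h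

/-- The cumulative Top-`k`-regret of a history, for parameters in decreasing order (item `i` of
`Fin n` is the item of rank `i + 1`). -/
def topRegret {n k : ℕ} (θ : Fin n → ℝ) (h : History n k) : ℝ :=
  (h.map fun r => (∑ i : Fin n with i.val < k, θ i - ∑ i ∈ r.played, θ i) / (k : ℝ)).sum

/-- `f(δ) = [2 α n² / ((2 α - 1) δ)] ^ (1 / (2 α - 1))`. -/
def burnIn (n : ℕ) (α δ : ℝ) : ℝ :=
  (2 * α * (n : ℝ) ^ 2 / ((2 * α - 1) * δ)) ^ (1 / (2 * α - 1))

/-- The constant `D^g_ij` of a pair of items with `θ j < θ g`, according to whether `i` is as good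
as `g`, better than `g`, or worse than `g`. -/
def pairComplexity {n : ℕ} (θ : Fin n → ℝ) (α : ℝ) (g i j : Fin n) : ℝ :=
  if θ i = θ g then 4 * α / (pref θ g j - 1 / 2) ^ 2
  else if θ g < θ i then 4 * α / (pref θ g i - pref θ j i) ^ 2
  else 4 * α / min ((pref θ g i - 1 / 2) ^ 2) ((pref θ g j - 1 / 2) ^ 2)

/-- The constant `D^(g)`: the sum of `D^g_ij` over the pairs `i < j` with `θ j < θ g`, for
parameters in decreasing order (every pair with at least one item worse than `g` occurs once). -/
def itemComplexity {n : ℕ} (θ : Fin n → ℝ) (α : ℝ) (g : Fin n) : ℝ :=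
  ∑ j : Fin n with θ j < θ g, ∑ i : Fin n with i < j, pairComplexity θ α g i j

/-- The instance-dependent constant: the sum of `D^(g)` over the `k` best items `g`. -/
def totalComplexity {n : ℕ} (θ : Fin n → ℝ) (α : ℝ) (k : ℕ) : ℝ :=
  ∑ g : Fin n with g.val < k, itemComplexity θ α g

/-- `Δ'_max = (∑_{i ≤ k} θ_i - ∑_{i > n - k} θ_i) / k`. -/
def maxRegret {n : ℕ} (θ : Fin n → ℝ) (k : ℕ) : ℝ :=
  (∑ i : Fin n with i.val < k, θ i - ∑ i : Fin n with n - k ≤ i.val, θ i) / (k : ℝ)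

/-- `D̂ = min_{g ∈ [k-1]} (p_{kg} - p_{bg})`, where `κ` is the item of rank `k`. -/
def dHat {n : ℕ} (θ : Fin n → ℝ) (k : ℕ) (κ b : Fin n) : ℝ :=
  ⨅ g : {g : Fin n // (g : ℕ) + 1 < k}, (pref θ κ g - pref θ b g)

/-- The term `(4 α ln T / k) ∑_{b > k} (θ_k - θ_b) / D̂²`, where `κ` is the item of rank `k`. -/
def saturationTerm {n : ℕ} (θ : Fin n → ℝ) (α : ℝ) (k : ℕ) (κ : Fin n) (T : ℕ) : ℝ :=
  4 * α * Real.log T / (k : ℝ) *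
    ∑ b : Fin n with k ≤ b.val, (θ κ - θ b) / (dHat θ k κ b) ^ 2

end

/-!
# A regret bound for Rec-MaxMin-UCB

Probability. By independence of irrelevant alternatives, a full ranking of a set that contains `i`
and `j` puts `i` before `j` with probability `p_ij`, whatever the set is (`topRanking_expect`). So
the exponential of the deviation of the wins of `i` against `j`, stopped after `N` comparisons, is a
supermartingale although the sets are chosen adaptively, and Hoeffding's inequality holds for the
empirical preference after `N` comparisons (`runLaw_deviation_le`). If a confidence bound with `N`
comparisons fails after round `f(δ)`, then the number of the round is at least `max (f(δ), N)`;
a union bound over the ordered pairs and over `N ≥ 1`, with the sum over `N` compared to an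
integral, shows that with probability at least `1 - δ` all bounds `p_ij < u_ij` hold strictly after
round `f(δ)` (`runLaw_not_confidentAfter_le`). The rest is deterministic.

One round. Since the bounds are strict, the best items of any pool are potential winners, also when
there are ties. Call a slot right if it holds a best item among those not held by earlier slots.
Right slots remain right. If the first `L` slots are right and the next one is not, then either the
next one becomes right, or some pair of played items has been compared at most `D^g_ij ln t` times,
where `g` is the item of rank `L + 1` (`LegalMove.progress`). Two facts about confidence bounds give
such a pair: `u_ji` is less than `p_ji + 2c` for the confidence radius `c` of the pair
(`comps_le_of_le_ucb`), and `u_ij + u_ji = 1 + 2c` (`comps_le_of_half_lt_ucb`). The second one deals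
with a wrong item that a slot keeps as a potential winner and with the max-min choices made after
it. If all slots but the last one are right, then the set played consists of their items and one
more item; when that item `b` is worse than the item of rank `k`, it has been compared at most
`4 α ln t / D̂_b²` times with one of the others (`LegalMove.saturated`).

Counting. Each round before the one in which the first `k - 1` slots have become right is among the
first `f(δ)` rounds, is charged to a pair, or makes one more slot right. The tangent of the
logarithm at `2D` turns this into the bound `2f + 2D ln (2D)`. As every `D^g_ij` is at least `8`, this bound
even leaves room for one more round for each item `b` not among the best `k` (`badCount_add_le`),
which pays for the round that the count `4 α ln T / D̂_b² + 1` (`saturatedCount_le`) has in excess.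
-/

/-! ### Expectations under a probability mass function -/

/-- The expectation of a function with values in `[0, ∞]`. -/
noncomputable def PMF.expect {A : Type*} (μ : PMF A) (F : A → ℝ≥0∞) : ℝ≥0∞ := ∑' x, μ x * F x

theorem PMF.expect_pure {A : Type*} (a : A) (F : A → ℝ≥0∞) : (PMF.pure a).expect F = F a := by
  unfold PMF.expect
  rw [tsum_eq_single a]
  · simp
  · intro b hb
    simp [PMF.pure_apply_of_ne _ _ hb]

theorem PMF.expect_bind {A B : Type*} (μ : PMF A) (κ : A → PMF B) (F : B → ℝ≥0∞) :
    (μ.bind κ).expect F = μ.expect fun a => (κ a).expect F := by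
  unfold PMF.expect
  simp_rw [PMF.bind_apply, ← ENNReal.tsum_mul_left, ← ENNReal.tsum_mul_right]
  rw [ENNReal.tsum_comm]
  simp_rw [mul_assoc]

theorem PMF.expect_map {A B : Type*} (μ : PMF A) (f : A → B) (F : B → ℝ≥0∞) :
    (μ.map f).expect F = μ.expect fun a => F (f a) := by
  unfold PMF.map
  rw [PMF.expect_bind]
  simp [PMF.expect_pure]

theorem PMF.expect_mono {A : Type*} (μ : PMF A) {F G : A → ℝ≥0∞}
    (h : ∀ x ∈ μ.support, F x ≤ G x) : μ.expect F ≤ μ.expect G := by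
  refine ENNReal.tsum_le_tsum fun x => ?_
  by_cases hx : x ∈ μ.support
  · exact mul_le_mul_right (h x hx) _
  · rw [(PMF.apply_eq_zero_iff _ _).2 hx]
    simp

theorem PMF.expect_congr {A : Type*} (μ : PMF A) {F G : A → ℝ≥0∞}
    (h : ∀ x ∈ μ.support, F x = G x) : μ.expect F = μ.expect G :=
  le_antisymm (μ.expect_mono fun x hx => (h x hx).le) (μ.expect_mono fun x hx => (h x hx).ge)

theorem PMF.expect_const {A : Type*} (μ : PMF A) (c : ℝ≥0∞) : (μ.expect fun _ => c) = c := by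
  unfold PMF.expect
  rw [ENNReal.tsum_mul_right, PMF.tsum_coe, one_mul]

/-- Markov's inequality. -/
theorem PMF.mul_toOuterMeasure_le_expect {A : Type*} (μ : PMF A) (F : A → ℝ≥0∞) (c : ℝ≥0∞)
    (s : Set A) (h : ∀ x ∈ s, c ≤ F x) : c * μ.toOuterMeasure s ≤ μ.expect F := by
  rw [PMF.toOuterMeasure_apply, ← ENNReal.tsum_mul_left]
  refine ENNReal.tsum_le_tsum fun x => ?_
  by_cases hx : x ∈ s
  · rw [Set.indicator_of_mem hx, mul_comm]
    exact mul_le_mul_right (h x hx) _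
  · rw [Set.indicator_of_notMem hx]
    simp

/-- A lower bound on a probability from an upper bound on that of the complement. -/
theorem PMF.ofReal_one_sub_le {A : Type*} (μ : PMF A) (s t : Set A) {ε : ℝ} (hε : 0 ≤ ε)
    (ht : μ.toOuterMeasure t ≤ ENNReal.ofReal ε) (hst : ∀ x ∈ μ.support, x ∉ t → x ∈ s) :
    ENNReal.ofReal (1 - ε) ≤ μ.toOuterMeasure s := by
  have h1 : (1 : ℝ≥0∞) ≤ μ.toOuterMeasure s + μ.toOuterMeasure t := by
    have h : μ.toOuterMeasure (s ∪ t) = 1 := by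
      rw [PMF.toOuterMeasure_apply_eq_one_iff]
      intro x hx
      by_cases hxt : x ∈ t
      · exact Or.inr hxt
      · exact Or.inl (hst x hx hxt)
    rw [← h]
    exact MeasureTheory.measure_union_le _ _
  rw [ENNReal.ofReal_sub _ hε, ENNReal.ofReal_one]
  exact tsub_le_iff_right.2 (h1.trans (add_le_add_right ht _))

/-! ### Rankings -/

theorem mnlChoice_expect {n : ℕ} (θ : Fin n → ℝ) (hθ : ∀ i, 0 < θ i) (S : Finset (Fin n))
    (hS : S.Nonempty) (F : Fin n → ℝ≥0∞) :
    (mnlChoice θ hθ S hS).expect F =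
      ∑ l ∈ S, ENNReal.ofReal (θ l / ∑ j ∈ S, θ j) * F l := by
  unfold PMF.expect mnlChoice
  simp only [PMF.ofFinset_apply, tsum_fintype]
  rw [← Finset.sum_subset (Finset.subset_univ S)]
  · exact Finset.sum_congr rfl fun l hl => by rw [if_pos hl]
  · intro l _ hl
    rw [if_neg hl, zero_mul]

/-- A ranking that is long enough lists the set that is played. -/
theorem topRanking_support {n : ℕ} (θ : Fin n → ℝ) (hθ : ∀ i, 0 < θ i) (m : ℕ)
    (S : Finset (Fin n)) (hm : S.card ≤ m) (σ : List (Fin n))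
    (hσ : σ ∈ (topRanking θ hθ m S).support) : ∀ i, i ∈ σ ↔ i ∈ S := by
  induction m generalizing S σ with
  | zero =>
    have : S = ∅ := Finset.card_eq_zero.1 (by omega)
    subst this
    simp only [topRanking, PMF.mem_support_pure_iff] at hσ
    simp [hσ]
  | succ m ih =>
    unfold topRanking at hσ
    split_ifs at hσ with hS
    · rw [PMF.mem_support_bind_iff] at hσ
      obtain ⟨l, hl, hσ⟩ := hσ
      rw [PMF.mem_support_map_iff] at hσ
      obtain ⟨τ, hτ, rfl⟩ := hσ
      have hlS : l ∈ S := by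
        by_contra hlS
        rw [PMF.mem_support_iff] at hl
        apply hl
        simp [mnlChoice, PMF.ofFinset_apply, hlS]
      have := ih (S.erase l) (by rw [Finset.card_erase_of_mem hlS]; omega) τ hτ
      intro i
      rw [List.mem_cons, this, Finset.mem_erase]
      by_cases h : i = l <;> simp [h, hlS]
    · rw [PMF.mem_support_pure_iff] at hσ
      rw [Finset.not_nonempty_iff_eq_empty] at hS
      simp [hσ, hS]

theorem pref_add_pref {n : ℕ} (θ : Fin n → ℝ) (hθ : ∀ i, 0 < θ i) (i j : Fin n) :
    pref θ i j + pref θ j i = 1 := by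
  unfold pref
  have := hθ i
  have := hθ j
  rw [add_comm (θ j), ← add_div, div_self (by linarith)]

theorem pref_pos {n : ℕ} (θ : Fin n → ℝ) (hθ : ∀ i, 0 < θ i) (i j : Fin n) :
    0 < pref θ i j := div_pos (hθ i) (add_pos (hθ i) (hθ j))

open Classical in
/-- Independence of irrelevant alternatives: in a full ranking of `S`, item `i` comes before item
`j` with probability `p_ij`, whatever the other items of `S` are. -/
theorem topRanking_expect {n : ℕ} (θ : Fin n → ℝ) (hθ : ∀ i, 0 < θ i) (m : ℕ)
    (S : Finset (Fin n)) (hm : S.card ≤ m) (i j : Fin n) (hi : i ∈ S) (hj : j ∈ S) (hij : i ≠ j)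
    (a b : ℝ≥0∞) :
    ((topRanking θ hθ m S).expect fun σ => if σ.idxOf i < σ.idxOf j then a else b) =
      ENNReal.ofReal (pref θ i j) * a + ENNReal.ofReal (pref θ j i) * b := by
  induction m generalizing S with
  | zero =>
    have : S = ∅ := Finset.card_eq_zero.1 (by omega)
    simp [this] at hi
  | succ m ih =>
    have hS : S.Nonempty := ⟨i, hi⟩
    set X := ENNReal.ofReal (pref θ i j) * a + ENNReal.ofReal (pref θ j i) * b with hX
    set s := ∑ l ∈ S, θ l with hs
    have hspos : 0 < s := Finset.sum_pos (fun l _ => hθ l) hS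
    unfold topRanking
    rw [dif_pos hS, PMF.expect_bind, mnlChoice_expect]
    simp_rw [PMF.expect_map]
    have hji : j ∈ S.erase i := Finset.mem_erase.2 ⟨hij.symm, hj⟩
    rw [← Finset.add_sum_erase _ _ hi, ← Finset.add_sum_erase _ _ hji]
    have e1 : ((topRanking θ hθ m (S.erase i)).expect fun σ =>
        if (i :: σ).idxOf i < (i :: σ).idxOf j then a else b) = a := by
      refine (PMF.expect_congr _ fun σ _ => ?_).trans (PMF.expect_const _ a)
      rw [if_pos]
      rw [List.idxOf_cons_self, List.idxOf_cons_ne _ hij]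
      exact Nat.succ_pos _
    have e2 : ((topRanking θ hθ m (S.erase j)).expect fun σ =>
        if (j :: σ).idxOf i < (j :: σ).idxOf j then a else b) = b := by
      refine (PMF.expect_congr _ fun σ _ => ?_).trans (PMF.expect_const _ b)
      rw [if_neg]
      rw [List.idxOf_cons_self]
      exact Nat.not_lt_zero _
    have e3 : ∀ l ∈ (S.erase i).erase j, ENNReal.ofReal (θ l / s) *
        ((topRanking θ hθ m (S.erase l)).expect fun σ =>
          if (l :: σ).idxOf i < (l :: σ).idxOf j then a else b) = ENNReal.ofReal (θ l / s) * X := by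
      intro l hl
      simp only [Finset.mem_erase] at hl
      obtain ⟨hlj, hli, hlS⟩ := hl
      congr 1
      rw [← ih (S.erase l) (by rw [Finset.card_erase_of_mem hlS]; omega)
        (Finset.mem_erase.2 ⟨hli.symm, hi⟩) (Finset.mem_erase.2 ⟨hlj.symm, hj⟩)]
      congr 1
      funext σ
      rw [List.idxOf_cons_ne _ hli, List.idxOf_cons_ne _ hlj]
      simp
    rw [e1, e2, Finset.sum_congr rfl e3, ← Finset.sum_mul,
      ← ENNReal.ofReal_sum_of_nonneg (fun l _ => (div_pos (hθ l) hspos).le), ← Finset.sum_div]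
    have hi0 := hθ i
    have hj0 := hθ j
    have h1 : θ i / s = (θ i + θ j) / s * pref θ i j := by
      unfold pref
      field_simp
    have h2 : θ j / s = (θ i + θ j) / s * pref θ j i := by
      unfold pref
      rw [add_comm (θ j)]
      field_simp
    have hq : 0 ≤ (θ i + θ j) / s := by positivity
    rw [h1, h2, ENNReal.ofReal_mul hq, ENNReal.ofReal_mul hq, ← add_assoc, mul_assoc, mul_assoc,
      ← mul_add, ← hX, ← add_mul, ← ENNReal.ofReal_add hq
        (div_nonneg (Finset.sum_nonneg fun l _ => (hθ l).le) hspos.le), ← add_div]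
    have h3 : θ i + θ j + ∑ l ∈ (S.erase i).erase j, θ l = s := by
      rw [add_assoc, Finset.add_sum_erase _ _ hji, Finset.add_sum_erase _ _ hi]
    rw [h3, div_self hspos.ne', ENNReal.ofReal_one, one_mul]

/-! ### Deviations of the empirical preferences -/

theorem wins_cons {n k : ℕ} (r : Round n k) (h : History n k) (i j : Fin n)
    [Decidable (r.Beats i j)] :
    wins (r :: h) i j = wins h i j + if r.Beats i j then 1 else 0 := by
  unfold wins
  rw [List.countP_cons]
  simp

/-- The number of comparisons of `i` and `j`. -/
noncomputable def comps {n k : ℕ} (h : History n k) (i j : Fin n) : ℕ := wins h i j + wins h j i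

theorem comps_comm {n k : ℕ} (h : History n k) (i j : Fin n) : comps h i j = comps h j i :=
  add_comm _ _

theorem wins_le_cons {n k : ℕ} (r : Round n k) (h : History n k) (i j : Fin n) :
    wins h i j ≤ wins (r :: h) i j := by
  classical
  rw [wins_cons]
  exact Nat.le_add_right _ _

theorem comps_le_cons {n k : ℕ} (r : Round n k) (h : History n k) (i j : Fin n) :
    comps h i j ≤ comps (r :: h) i j :=
  add_le_add (wins_le_cons r h i j) (wins_le_cons r h j i)

theorem comps_le_of_suffix {n k : ℕ} {h' h : History n k} (hs : h' <:+ h) (i j : Fin n) :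
    comps h' i j ≤ comps h i j := by
  induction h with
  | nil => rw [List.suffix_nil.1 hs]
  | cons r h ih =>
    rcases List.suffix_cons_iff.1 hs with rfl | hs
    · exact le_rfl
    · exact (ih hs).trans (comps_le_cons r h i j)

/-- Hoeffding's lemma for a centred Bernoulli variable. -/
theorem bernoulli_mgf_le (p q s : ℝ) (hp : 0 ≤ p) (hq : 0 ≤ q) (hpq : p + q = 1) :
    p * Real.exp (s * (p - 1)) + q * Real.exp (s * p) ≤ Real.exp (s ^ 2 / 8) := by
  have hq' : q = 1 - p := by linarith
  subst hq'
  let μ : MeasureTheory.Measure ℝ := ENNReal.ofReal p • MeasureTheory.Measure.dirac (p - 1)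
    + ENNReal.ofReal (1 - p) • MeasureTheory.Measure.dirac p
  have hμ : MeasureTheory.IsProbabilityMeasure μ := ⟨by
    simp only [μ, MeasureTheory.Measure.coe_add, MeasureTheory.Measure.coe_smul, Pi.add_apply,
      Pi.smul_apply, MeasureTheory.measure_univ, smul_eq_mul, mul_one]
    rw [← ENNReal.ofReal_add hp hq]
    simp⟩
  have hint : ∀ F : ℝ → ℝ, ∫ x, F x ∂μ = p * F (p - 1) + (1 - p) * F p := by
    intro F
    have hi : ∀ a b : ℝ, MeasureTheory.Integrable F
        (ENNReal.ofReal a • MeasureTheory.Measure.dirac b) := fun a b =>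
      MeasureTheory.Integrable.smul_measure
        (MeasureTheory.integrable_dirac (by simp)) ENNReal.ofReal_ne_top
    rw [MeasureTheory.integral_add_measure (hi _ _) (hi _ _)]
    simp [MeasureTheory.integral_smul_measure, MeasureTheory.integral_dirac, hp, hq]
  have hsub := ProbabilityTheory.hasSubgaussianMGF_of_mem_Icc_of_integral_eq_zero (μ := μ)
    (X := fun x => x) (a := p - 1) (b := p) aemeasurable_id' (by
      simp only [μ]
      rw [MeasureTheory.ae_add_measure_iff]
      constructor
      · exact MeasureTheory.Measure.ae_smul_measure (by
          rw [MeasureTheory.ae_dirac_eq]; simp) _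
      · exact MeasureTheory.Measure.ae_smul_measure (by
          rw [MeasureTheory.ae_dirac_eq]; simp) _)
    (by rw [hint]; ring)
  have h := hsub.mgf_le s
  rw [ProbabilityTheory.mgf, hint] at h
  refine h.trans (le_of_eq ?_)
  congr 1
  simp
  ring

/-- In a full ranking of the played set, `i` beats `j` if and only if both are played and `i` is
ranked before `j`. -/
theorem Round.beats_iff {n k : ℕ} {r : Round n k} (hr : ∀ i, i ∈ r.ranking ↔ i ∈ r.played)
    {i j : Fin n} : r.Beats i j ↔
      i ∈ r.played ∧ j ∈ r.played ∧ r.ranking.idxOf i < r.ranking.idxOf j := by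
  unfold Round.Beats
  rw [hr]

theorem Round.Beats.not_symm {n k : ℕ} {r : Round n k} {i j : Fin n} (h : r.Beats i j) :
    ¬ r.Beats j i := fun h' => absurd h.2.2 (not_lt.2 h'.2.2.le)

open Classical in
theorem comps_cons {n k : ℕ} {r : Round n k} (hr : ∀ i, i ∈ r.ranking ↔ i ∈ r.played)
    (h : History n k) {i j : Fin n} (hij : i ≠ j) :
    comps (r :: h) i j = comps h i j + if i ∈ r.played ∧ j ∈ r.played then 1 else 0 := by
  unfold comps
  rw [wins_cons, wins_cons]
  by_cases hp : i ∈ r.played ∧ j ∈ r.played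
  · have hne : r.ranking.idxOf i ≠ r.ranking.idxOf j := fun h =>
      hij ((List.idxOf_inj ((hr i).2 hp.1)).1 h)
    rw [if_pos hp]
    rcases lt_or_gt_of_ne hne with hlt | hlt
    · have h1 : r.Beats i j := (Round.beats_iff hr).2 ⟨hp.1, hp.2, hlt⟩
      rw [if_pos h1, if_neg h1.not_symm]
      omega
    · have h1 : r.Beats j i := (Round.beats_iff hr).2 ⟨hp.2, hp.1, hlt⟩
      rw [if_pos h1, if_neg h1.not_symm]
      omega
  · rw [if_neg hp,
      if_neg fun hb => hp ⟨((Round.beats_iff hr).1 hb).1, ((Round.beats_iff hr).1 hb).2.1⟩,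
      if_neg fun hb => hp ⟨((Round.beats_iff hr).1 hb).2.1, ((Round.beats_iff hr).1 hb).1⟩]
    omega

theorem comps_le_length {n k : ℕ} (h : History n k) (i j : Fin n) : comps h i j ≤ h.length := by
  classical
  induction h with
  | nil => simp [comps, wins]
  | cons r h ih =>
    have : comps (r :: h) i j ≤ comps h i j + 1 := by
      unfold comps
      rw [wins_cons, wins_cons]
      by_cases hb : r.Beats i j
      · rw [if_pos hb, if_neg hb.not_symm]
        omega
      · rw [if_neg hb]
        split_ifs <;> omega
    rw [List.length_cons]
    omega

/-- The exponential of the deviation of the number of wins of `i` against `j` below its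
conditional mean, normalised as in Hoeffding's inequality. -/
noncomputable def tilt {n k : ℕ} (θ : Fin n → ℝ) (i j : Fin n) (s : ℝ) (h : History n k) : ℝ :=
  Real.exp (s * (pref θ i j * comps h i j - wins h i j) - s ^ 2 / 8 * comps h i j)

open Classical in
/-- The process `tilt`, stopped as soon as `i` and `j` have been compared `N` times. -/
noncomputable def stoppedTilt {n k : ℕ} (θ : Fin n → ℝ) (i j : Fin n) (s : ℝ) (N : ℕ) :
    History n k → ℝ≥0∞
  | [] => 1
  | r :: h => if comps h i j < N then ENNReal.ofReal (tilt θ i j s (r :: h))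
      else stoppedTilt θ i j s N h

theorem stoppedTilt_of_lt {n k : ℕ} (θ : Fin n → ℝ) (i j : Fin n) (s : ℝ) (N : ℕ)
    (h : History n k) (hN : comps h i j < N) :
    stoppedTilt θ i j s N h = ENNReal.ofReal (tilt θ i j s h) := by
  cases h with
  | nil => simp [stoppedTilt, tilt, comps, wins]
  | cons r h =>
    unfold stoppedTilt
    rw [if_pos ((comps_le_cons r h i j).trans_lt hN)]

/-- All histories with exactly `N` comparisons along a run have the same wins, hence the same value
of `tilt`, and this is the value at which the process stops. -/
theorem stoppedTilt_of_suffix {n k : ℕ} (θ : Fin n → ℝ) (i j : Fin n) (s : ℝ) (N : ℕ) (hN : 0 < N)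
    (h h' : History n k) (hs : h' <:+ h) (hh : comps h' i j = N) :
    stoppedTilt θ i j s N h = ENNReal.ofReal (tilt θ i j s h') := by
  induction h generalizing h' with
  | nil =>
    rw [List.suffix_nil.1 hs] at hh
    simp [comps, wins] at hh
    omega
  | cons r h ih =>
    unfold stoppedTilt
    rcases List.suffix_cons_iff.1 hs with rfl | hs
    · split_ifs with hlt
      · rfl
      · have h1 := wins_le_cons r h i j
        have h2 := wins_le_cons r h j i
        have h3 : comps h i j = N := le_antisymm (hh ▸ comps_le_cons r h i j) (not_lt.1 hlt)
        rw [ih h (List.suffix_refl h) h3]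
        have h4 : wins (r :: h) i j = wins h i j := by
          unfold comps at hh h3
          omega
        unfold tilt
        rw [hh, h3, h4]
    · rw [if_neg (not_lt.2 (hh ▸ comps_le_of_suffix hs i j)), ih h' hs hh]

/-- The stopped process is a supermartingale. -/
theorem stoppedTilt_step {n k : ℕ} (θ : Fin n → ℝ) (hθ : ∀ i, 0 < θ i) (i j : Fin n) (hij : i ≠ j)
    (s : ℝ) (N : ℕ) (h : History n k) (B : Fin k → Option (Fin n)) (S : Finset (Fin n))
    (hS : S.card ≤ k) :
    ((topRanking θ hθ k S).expect fun σ => stoppedTilt θ i j s N (⟨B, S, σ⟩ :: h)) ≤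
      stoppedTilt θ i j s N h := by
  classical
  by_cases hN : comps h i j < N
  · rw [stoppedTilt_of_lt _ _ _ _ _ _ hN]
    simp only [stoppedTilt, if_pos hN]
    by_cases hp : i ∈ S ∧ j ∈ S
    · have key : ((topRanking θ hθ k S).expect fun σ =>
          ENNReal.ofReal (tilt θ i j s ((⟨B, S, σ⟩ : Round n k) :: h))) =
          (topRanking θ hθ k S).expect fun σ => if σ.idxOf i < σ.idxOf j then
            ENNReal.ofReal
              (tilt θ i j s h * (Real.exp (s * (pref θ i j - 1)) * Real.exp (-(s ^ 2 / 8))))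
            else ENNReal.ofReal
              (tilt θ i j s h * (Real.exp (s * pref θ i j) * Real.exp (-(s ^ 2 / 8)))) := by
        refine PMF.expect_congr _ fun σ hσ => ?_
        have hr : ∀ l, l ∈ (⟨B, S, σ⟩ : Round n k).ranking ↔ l ∈ (⟨B, S, σ⟩ : Round n k).played :=
          topRanking_support θ hθ k S hS σ hσ
        have hc := comps_cons hr h hij
        rw [if_pos hp] at hc
        have hw := wins_cons (⟨B, S, σ⟩ : Round n k) h i j
        unfold tilt
        rw [hc, hw]
        by_cases hlt : σ.idxOf i < σ.idxOf j
        · rw [if_pos ((Round.beats_iff hr).2 ⟨hp.1, hp.2, hlt⟩), if_pos hlt, ← Real.exp_add,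
            ← Real.exp_add]
          congr 2
          push_cast
          ring
        · rw [if_neg fun hb => hlt ((Round.beats_iff hr).1 hb).2.2, if_neg hlt, ← Real.exp_add,
            ← Real.exp_add]
          congr 2
          push_cast
          ring
      rw [key, topRanking_expect θ hθ k S hS i j hp.1 hp.2 hij,
        ← ENNReal.ofReal_mul (pref_pos θ hθ i j).le, ← ENNReal.ofReal_mul (pref_pos θ hθ j i).le,
        ← ENNReal.ofReal_add (by unfold tilt; have := pref_pos θ hθ i j; positivity)
          (by unfold tilt; have := pref_pos θ hθ j i; positivity)]
      apply ENNReal.ofReal_le_ofReal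
      have hb := bernoulli_mgf_le (pref θ i j) (pref θ j i) s (pref_pos θ hθ i j).le
        (pref_pos θ hθ j i).le (pref_add_pref θ hθ i j)
      have h1 : Real.exp (s ^ 2 / 8) * Real.exp (-(s ^ 2 / 8)) = 1 := by
        rw [← Real.exp_add, add_neg_cancel, Real.exp_zero]
      calc _ = tilt θ i j s h * ((pref θ i j * Real.exp (s * (pref θ i j - 1))
            + pref θ j i * Real.exp (s * pref θ i j)) * Real.exp (-(s ^ 2 / 8))) := by ring
        _ ≤ tilt θ i j s h * (Real.exp (s ^ 2 / 8) * Real.exp (-(s ^ 2 / 8))) := by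
          have h0 : 0 ≤ tilt θ i j s h := (Real.exp_pos _).le
          gcongr
        _ = tilt θ i j s h := by rw [h1, mul_one]
    · refine le_of_eq ((PMF.expect_congr _ fun σ hσ => ?_).trans (PMF.expect_const _ _))
      have hr : ∀ l, l ∈ (⟨B, S, σ⟩ : Round n k).ranking ↔ l ∈ (⟨B, S, σ⟩ : Round n k).played :=
        topRanking_support θ hθ k S hS σ hσ
      have hc := comps_cons hr h hij
      rw [if_neg hp] at hc
      have hw := wins_cons (⟨B, S, σ⟩ : Round n k) h i j
      rw [if_neg fun hb => hp ⟨((Round.beats_iff hr).1 hb).1, ((Round.beats_iff hr).1 hb).2.1⟩] at hw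
      unfold tilt
      rw [hc, hw]
      simp
  · simp only [stoppedTilt, if_neg hN]
    rw [PMF.expect_const]

theorem runLaw_expect_stoppedTilt_le_one {n k : ℕ} (θ : Fin n → ℝ) (hθ : ∀ i, 0 < θ i)
    (rule : Rule n k) (hcard : ∀ h, ∀ m ∈ (rule h).support, m.2.card ≤ k) (i j : Fin n)
    (hij : i ≠ j) (s : ℝ) (N T : ℕ) :
    (runLaw θ hθ rule T).expect (stoppedTilt θ i j s N) ≤ 1 := by
  induction T with
  | zero =>
    unfold runLaw
    rw [PMF.expect_pure]
    rfl
  | succ T ih =>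
    unfold runLaw
    rw [PMF.expect_bind]
    refine le_trans (PMF.expect_mono _ fun h _ => ?_) ih
    rw [PMF.expect_bind, ← PMF.expect_const (rule h) (stoppedTilt θ i j s N h)]
    refine PMF.expect_mono _ fun m hm => ?_
    rw [PMF.expect_map]
    exact stoppedTilt_step θ hθ i j hij s N h m.1 m.2 (hcard h m hm)

/-- Hoeffding's inequality for the empirical preference after `N` comparisons, whenever they are
made. -/
theorem runLaw_deviation_le {n k : ℕ} (θ : Fin n → ℝ) (hθ : ∀ i, 0 < θ i)
    (rule : Rule n k) (hcard : ∀ h, ∀ m ∈ (rule h).support, m.2.card ≤ k) (i j : Fin n)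
    (hij : i ≠ j) (N T : ℕ) (hN : 0 < N) (c : ℝ) (hc : 0 ≤ c) :
    (runLaw θ hθ rule T).toOuterMeasure {h | ∃ h', h' <:+ h ∧ comps h' i j = N ∧
      (wins h' i j : ℝ) + N * c ≤ pref θ i j * N} ≤ ENNReal.ofReal (Real.exp (-(2 * N * c ^ 2))) := by
  -- `s = 4 c` minimizes the exponent `-s N c + s² N / 8`.
  have hM := PMF.mul_toOuterMeasure_le_expect (runLaw θ hθ rule T) (stoppedTilt θ i j (4 * c) N)
    (ENNReal.ofReal (Real.exp (2 * N * c ^ 2))) {h | ∃ h', h' <:+ h ∧ comps h' i j = N ∧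
      (wins h' i j : ℝ) + N * c ≤ pref θ i j * N} (by
      rintro h ⟨h', hs, hh, hw⟩
      rw [stoppedTilt_of_suffix θ i j _ N hN h h' hs hh]
      apply ENNReal.ofReal_le_ofReal
      unfold tilt
      apply Real.exp_le_exp.2
      rw [hh]
      have := mul_le_mul_of_nonneg_left hw hc
      nlinarith)
  have h1 := hM.trans (runLaw_expect_stoppedTilt_le_one θ hθ rule hcard i j hij _ N T)
  rw [Real.exp_neg, ENNReal.ofReal_inv_of_pos (Real.exp_pos _), ← one_div,
    ENNReal.le_div_iff_mul_le (Or.inl (by simp [Real.exp_pos])) (Or.inl ENNReal.ofReal_ne_top),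
    mul_comm]
  exact h1

/-- Comparison with an integral: `∑_{N ≥ 1} max(f, N)^{-2α} ≤ 2α / (2α - 1) · f^{1 - 2α}`. -/
theorem sum_max_rpow_le (α f : ℝ) (hα : 1 / 2 < α) (hf : 0 < f) (T : ℕ) :
    ∑ N ∈ Finset.Icc 1 T, (max f (N : ℝ)) ^ (-(2 * α)) ≤
      2 * α / (2 * α - 1) * f ^ (-(2 * α) + 1) := by
  set g : ℝ → ℝ := fun x => (max f x) ^ (-(2 * α)) with hg
  have hcont : Continuous g := by
    apply Continuous.rpow_const (by fun_prop)
    intro x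
    left
    exact (lt_max_of_lt_left hf).ne'
  have hanti : Antitone g := by
    intro x y hxy
    apply Real.rpow_le_rpow_of_nonpos (lt_max_of_lt_left hf) (max_le_max le_rfl hxy)
    linarith
  have h1 := (hanti.antitoneOn (Set.Icc (0 : ℝ) (0 + T))).sum_le_integral
  have h2 : ∑ N ∈ Finset.Icc 1 T, g N = ∑ i ∈ Finset.range T, g (0 + ((i + 1 : ℕ) : ℝ)) := by
    rw [Finset.range_eq_Ico, Finset.sum_Ico_add' (fun i : ℕ => g (0 + (i : ℝ)))]
    simp
    rfl
  rw [h2]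
  refine h1.trans ?_
  have hm : (0 : ℝ) + T ≤ max f T := by simp
  have h3 : ∫ x in (0 : ℝ)..(0 + T), g x ≤ ∫ x in (0 : ℝ)..(max f T), g x := by
    apply intervalIntegral.integral_mono_interval le_rfl (by positivity) hm
    · exact Filter.Eventually.of_forall fun x => Real.rpow_nonneg (le_max_of_le_left hf.le) _
    · exact hcont.intervalIntegrable _ _
  refine h3.trans ?_
  rw [← intervalIntegral.integral_add_adjacent_intervals (hcont.intervalIntegrable 0 f)
    (hcont.intervalIntegrable f _)]
  have h4 : ∫ x in (0 : ℝ)..f, g x = f ^ (-(2 * α) + 1) := by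
    rw [intervalIntegral.integral_congr (g := fun _ => f ^ (-(2 * α)))]
    · rw [intervalIntegral.integral_const, Real.rpow_add_one hf.ne']
      simp
      ring
    · intro x hx
      rw [Set.uIcc_of_le hf.le] at hx
      simp only [hg]
      rw [max_eq_left hx.2]
  have h5 : ∫ x in f..(max f T), g x = ((max f T) ^ (-(2 * α) + 1) - f ^ (-(2 * α) + 1)) /
      (-(2 * α) + 1) := by
    rw [← integral_rpow]
    · apply intervalIntegral.integral_congr
      intro x hx
      rw [Set.uIcc_of_le (le_max_left _ _)] at hx
      simp only [hg]
      rw [max_eq_right hx.1]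
    · right
      refine ⟨by linarith, ?_⟩
      rw [Set.uIcc_of_le (le_max_left _ _)]
      exact fun h => absurd h.1 (not_le.2 hf)
  rw [h4, h5]
  have h6 : 0 ≤ (max f (T : ℝ)) ^ (-(2 * α) + 1) := Real.rpow_nonneg (le_max_of_le_left hf.le) _
  have h7 : (0 : ℝ) < 2 * α - 1 := by linarith
  have h8 : ((max f T) ^ (-(2 * α) + 1) - f ^ (-(2 * α) + 1)) / (-(2 * α) + 1) =
      f ^ (-(2 * α) + 1) / (2 * α - 1) - (max f (T : ℝ)) ^ (-(2 * α) + 1) / (2 * α - 1) := by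
    rw [show -(2 * α) + 1 = -(2 * α - 1) by ring, div_neg, ← sub_div, ← neg_div, neg_sub]
  rw [h8]
  have h9 : 0 ≤ (max f (T : ℝ)) ^ (-(2 * α) + 1) / (2 * α - 1) := by positivity
  have h10 : 2 * α / (2 * α - 1) * f ^ (-(2 * α) + 1) =
      f ^ (-(2 * α) + 1) + f ^ (-(2 * α) + 1) / (2 * α - 1) := by
    field_simp
    ring
  linarith

theorem burnIn_pos {n : ℕ} (hn : 0 < n) {α δ : ℝ} (hα : 1 / 2 < α) (hδ : 0 < δ) :
    0 < burnIn n α δ := by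
  unfold burnIn
  have : 0 < 2 * α - 1 := by linarith
  have : (0 : ℝ) < n := by exact_mod_cast hn
  have : 0 < α := by linarith
  positivity

/-- The burn-in time is such that the failure probabilities of the confidence bounds after it add
up to `δ`. -/
theorem burnIn_rpow {n : ℕ} (hn : 0 < n) {α δ : ℝ} (hα : 1 / 2 < α) (hδ : 0 < δ) :
    (n : ℝ) ^ 2 * (2 * α / (2 * α - 1) * (burnIn n α δ) ^ (-(2 * α) + 1)) = δ := by
  have h1 : 0 < 2 * α - 1 := by linarith
  have h2 : (0 : ℝ) < n := by exact_mod_cast hn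
  have h3 : 0 < α := by linarith
  unfold burnIn
  rw [← Real.rpow_mul (by positivity),
    show 1 / (2 * α - 1) * (-(2 * α) + 1) = -1 by field_simp; ring, Real.rpow_neg_one]
  field_simp

/-- After `f` rounds, all upper confidence bounds are strictly above the preferences. -/
def ConfidentAfter {n k : ℕ} (θ : Fin n → ℝ) (α f : ℝ) : History n k → Prop
  | [] => True
  | _ :: h => (f < (h.length + 1 : ℕ) → ∀ i j, i ≠ j →
      ((pref θ i j : ℝ) : EReal) < ucb α (h.length + 1) (wins h) i j) ∧ ConfidentAfter θ α f h

theorem not_confidentAfter {n k : ℕ} (θ : Fin n → ℝ) (α f : ℝ) (h : History n k)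
    (hc : ¬ ConfidentAfter θ α f h) : ∃ h' : History n k, h' <:+ h ∧ h'.length < h.length ∧
      f < (h'.length + 1 : ℕ) ∧ ∃ i j, i ≠ j ∧
        ucb α (h'.length + 1) (wins h') i j ≤ ((pref θ i j : ℝ) : EReal) := by
  induction h with
  | nil => exact absurd trivial hc
  | cons r h ih =>
    unfold ConfidentAfter at hc
    rw [not_and_or] at hc
    rcases hc with hc | hc
    · push Not at hc
      obtain ⟨hf, i, j, hij, hu⟩ := hc
      exact ⟨h, List.suffix_cons r h, by simp, hf, i, j, hij, hu⟩
    · obtain ⟨h', hs, hl, h2⟩ := ih hc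
      exact ⟨h', hs.trans (List.suffix_cons r h), by rw [List.length_cons]; omega, h2⟩

theorem runLaw_length {n k : ℕ} (θ : Fin n → ℝ) (hθ : ∀ i, 0 < θ i) (rule : Rule n k) (T : ℕ)
    (h : History n k) (hh : h ∈ (runLaw θ hθ rule T).support) : h.length = T := by
  induction T generalizing h with
  | zero =>
    simp only [runLaw, PMF.mem_support_pure_iff] at hh
    simp [hh]
  | succ T ih =>
    unfold runLaw at hh
    rw [PMF.mem_support_bind_iff] at hh
    obtain ⟨h', hh', hh⟩ := hh
    rw [PMF.mem_support_bind_iff] at hh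
    obtain ⟨m, -, hh⟩ := hh
    rw [PMF.mem_support_map_iff] at hh
    obtain ⟨σ, -, rfl⟩ := hh
    rw [List.length_cons, ih h' hh']

/-- With probability at least `1 - δ` all confidence bounds hold after the burn-in. A bound with `N`
comparisons that fails in round `t > f` has radius at least `√(α ln max(f, N) / N)`, since `t > N`;
so the failure probabilities for the ordered pairs and all `N` can be added up. -/
theorem runLaw_not_confidentAfter_le {n k : ℕ} (hn : 0 < n) (θ : Fin n → ℝ) (hθ : ∀ i, 0 < θ i)
    (rule : Rule n k) (hcard : ∀ h, ∀ m ∈ (rule h).support, m.2.card ≤ k) (α δ : ℝ)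
    (hα : 1 / 2 < α) (hδ : 0 < δ) (T : ℕ) :
    (runLaw θ hθ rule T).toOuterMeasure {h | ¬ ConfidentAfter θ α (burnIn n α δ) h} ≤
      ENNReal.ofReal δ := by
  set f := burnIn n α δ with hf
  have hf0 : 0 < f := burnIn_pos hn hα hδ
  have hα0 : 0 < α := by linarith
  let c : ℕ → ℝ := fun N => √(α * Real.log (max f N) / N)
  let E : Fin n → Fin n → ℕ → Set (History n k) := fun i j N =>
    {h | ∃ h', h' <:+ h ∧ comps h' i j = N ∧ (wins h' i j : ℝ) + N * c N ≤ pref θ i j * N}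
  let P : Finset ((Fin n × Fin n) × ℕ) :=
    (Finset.univ.filter fun p : Fin n × Fin n => p.1 ≠ p.2) ×ˢ Finset.Icc 1 T
  have hsub : {h | ¬ ConfidentAfter θ α f h} ∩ (runLaw θ hθ rule T).support ⊆
      ⋃ p ∈ P, E p.1.1 p.1.2 p.2 := by
    rintro h ⟨hbad, hsupp⟩
    obtain ⟨h', hs, hl, hft, i, j, hij, hu⟩ := not_confidentAfter θ α f h hbad
    rw [runLaw_length θ hθ rule T h hsupp] at hl
    have hlen := comps_le_length h' i j
    unfold ucb at hu
    rw [if_neg hij] at hu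
    change (if comps h' i j = 0 then ⊤ else _) ≤ _ at hu
    split_ifs at hu with h0
    · simp at hu
    · change (((wins h' i j : ℝ) / (comps h' i j : ℝ) +
        √(α * Real.log ((h'.length + 1 : ℕ) : ℝ) / (comps h' i j : ℝ)) : ℝ) : EReal) ≤ _ at hu
      rw [EReal.coe_le_coe_iff] at hu
      simp only [Set.mem_iUnion]
      refine ⟨((i, j), comps h' i j), by simp [P, hij]; omega, h', hs, rfl, ?_⟩
      have hN : (0 : ℝ) < comps h' i j := by exact_mod_cast Nat.pos_of_ne_zero h0
      have hcle : c (comps h' i j) ≤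
          √(α * Real.log ((h'.length + 1 : ℕ) : ℝ) / (comps h' i j : ℝ)) := by
        apply Real.sqrt_le_sqrt
        have hmax : max f (comps h' i j : ℝ) ≤ ((h'.length + 1 : ℕ) : ℝ) :=
          max_le hft.le (by exact_mod_cast hlen.trans (Nat.le_succ _))
        have := Real.log_le_log (lt_max_of_lt_left hf0) hmax
        gcongr
      have h1 := (add_le_add_right hcle _).trans hu
      have h2 := mul_le_mul_of_nonneg_right h1 hN.le
      rw [add_mul, div_mul_cancel₀ _ hN.ne'] at h2
      linarith
  refine (PMF.toOuterMeasure_mono _ hsub).trans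
    ((MeasureTheory.measure_biUnion_finset_le _ _).trans ?_)
  have hE : ∀ p ∈ P, (runLaw θ hθ rule T).toOuterMeasure (E p.1.1 p.1.2 p.2) ≤
      ENNReal.ofReal ((max f (p.2 : ℝ)) ^ (-(2 * α))) := by
    rintro ⟨⟨i, j⟩, N⟩ hp
    simp only [P, Finset.mem_product, Finset.mem_filter, Finset.mem_univ, true_and,
      Finset.mem_Icc] at hp
    refine (runLaw_deviation_le θ hθ rule hcard i j hp.1 N T hp.2.1 (c N)
      (Real.sqrt_nonneg _)).trans (ENNReal.ofReal_le_ofReal (le_of_eq ?_))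
    have hN : (1 : ℝ) ≤ N := by exact_mod_cast hp.2.1
    have hm : 1 ≤ max f (N : ℝ) := hN.trans (le_max_right _ _)
    have hl : 0 ≤ Real.log (max f N) := Real.log_nonneg hm
    simp only [c]
    rw [Real.sq_sqrt (by positivity), Real.rpow_def_of_pos (by linarith)]
    congr 1
    field_simp
  refine (Finset.sum_le_sum hE).trans ?_
  rw [← ENNReal.ofReal_sum_of_nonneg fun p _ => Real.rpow_nonneg (le_max_of_le_left hf0.le) _]
  apply ENNReal.ofReal_le_ofReal
  simp only [P]
  simp only [Finset.sum_product, Finset.sum_const, nsmul_eq_mul]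
  have hcardle : (((Finset.univ.filter fun p : Fin n × Fin n => p.1 ≠ p.2).card : ℕ) : ℝ) ≤
      (n : ℝ) ^ 2 := by
    have := Finset.card_filter_le (Finset.univ : Finset (Fin n × Fin n)) (fun p => p.1 ≠ p.2)
    rw [Finset.card_univ, Fintype.card_prod, Fintype.card_fin, ← sq] at this
    exact_mod_cast this
  calc _ ≤ (n : ℝ) ^ 2 * (2 * α / (2 * α - 1) * f ^ (-(2 * α) + 1)) :=
        mul_le_mul hcardle (sum_max_rpow_le α f hα hf0 T)
          (Finset.sum_nonneg fun N _ => Real.rpow_nonneg (le_max_of_le_left hf0.le) _) (by positivity)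
    _ = δ := burnIn_rpow hn hα hδ

/-! ### Sets built by the selection rule -/

theorem candidates_subset {n : ℕ} (U : Fin n → Fin n → EReal) (I : Finset (Fin n)) :
    candidates U I ⊆ I := by
  unfold candidates condorcet
  split_ifs
  · exact subset_rfl
  · exact Finset.filter_subset _ _

theorem MaxMinFill.shape {n : ℕ} {U : Fin n → Fin n → EReal} {C I S R : Finset (Fin n)} {ℓ : ℕ}
    (h : MaxMinFill U C I ℓ S R) : S ⊆ R ∧ R.card = S.card + ℓ := by
  induction h with
  | done S => simp
  | pick ℓ S R a ha hC hmax hR ih =>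
    have haS : a ∉ S := (Finset.mem_sdiff.1 ha).2
    rw [Finset.card_insert_of_notMem haS] at ih
    exact ⟨(Finset.subset_insert a S).trans ih.1, by omega⟩

theorem BuildS.shape {n : ℕ} {U : Fin n → Fin n → EReal} {I S R : Finset (Fin n)} {ℓ : ℕ}
    (h : BuildS U S I ℓ R) (hd : Disjoint S I) : S ⊆ R ∧ R.card = S.card + ℓ := by
  induction h with
  | all S I ℓ R hcard hR ih =>
    have hdc : Disjoint S (candidates U I) := hd.mono_right (candidates_subset U I)
    have hd' : Disjoint (S ∪ candidates U I) (I \ candidates U I) := by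
      rw [Finset.disjoint_union_left]
      exact ⟨hd.mono_right Finset.sdiff_subset, Finset.disjoint_sdiff⟩
    obtain ⟨h1, h2⟩ := ih hd'
    rw [Finset.card_union_of_disjoint hdc] at h2
    exact ⟨Finset.subset_union_left.trans h1, by omega⟩
  | fill S I ℓ R hcard hR => exact hR.shape

theorem SelectSet.shape {n k : ℕ} {U : Fin n → Fin n → EReal} {B' B : Fin k → Option (Fin n)}
    {h : Fin k} {I S R : Finset (Fin n)} (hs : SelectSet U B' B h I S R) (hd : Disjoint S I)
    (hS : S.card = h) : S ⊆ R ∧ R.card = k := by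
  induction hs with
  | keep h h' I S R i hh hi hiC hB hR ih =>
    have hiI : i ∈ I := (Finset.mem_filter.1 hiC).1
    have hiS : i ∉ S := fun h => Finset.disjoint_left.1 hd h hiI
    obtain ⟨h1, h2⟩ := ih (by
      rw [Finset.disjoint_insert_left]
      exact ⟨Finset.notMem_erase i I, hd.mono_right (Finset.erase_subset i I)⟩)
      (by rw [Finset.card_insert_of_notMem hiS, hS, hh])
    exact ⟨(Finset.subset_insert i S).trans h1, h2⟩
  | refill h I S R x hh hold hC hxI hx hB hrest hR =>
    have hxS : x ∉ S := fun h => Finset.disjoint_left.1 hd h hxI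
    obtain ⟨h1, h2⟩ := hR.shape (by
      rw [Finset.disjoint_insert_left]
      exact ⟨Finset.notMem_erase x I, hd.mono_right (Finset.erase_subset x I)⟩)
    have h3 := Finset.card_insert_of_notMem hxS
    exact ⟨(Finset.subset_insert x S).trans h1, by omega⟩
  | restart h I S R hh hC hB hrest hR =>
    obtain ⟨h1, h2⟩ := hR.shape hd
    have := h.2
    exact ⟨h1, by omega⟩
  | lastUnique h I S i hh hC hB =>
    have hiC : i ∈ condorcet U I := hC ▸ Finset.mem_singleton_self i
    have hiI : i ∈ I := (Finset.mem_filter.1 hiC).1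
    have hiS : i ∉ S := fun h => Finset.disjoint_left.1 hd h hiI
    exact ⟨Finset.subset_insert i S, by rw [Finset.card_insert_of_notMem hiS, hS, hh]⟩
  | lastOther h I S R hh hC hB hR =>
    obtain ⟨h1, h2⟩ := hR.shape hd
    exact ⟨h1, by omega⟩

theorem LegalMove.card {n k : ℕ} {α : ℝ} {h : History n k} {B : Fin k → Option (Fin n)}
    {S : Finset (Fin n)} (hm : LegalMove α h B S) : S.card = k := by
  obtain ⟨h₀, hh, hs⟩ := hm
  exact (hs.shape (Finset.disjoint_empty_left _) (by simp [hh])).2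

theorem MaxMinFill.one {n : ℕ} {U : Fin n → Fin n → EReal} {C I S R : Finset (Fin n)}
    (h : MaxMinFill U C I 1 S R) : ∃ a ∈ I, a ∉ S ∧ R = insert a S ∧ (S = ∅ → a ∈ C) ∧
      (S.Nonempty → ∀ c ∈ I, c ∉ S → ∃ s ∈ S, U c s ≤ U a s) := by
  cases h with
  | pick _ _ _ a ha hC hmax hR =>
    obtain ⟨haI, haS⟩ := Finset.mem_sdiff.1 ha
    refine ⟨a, haI, haS, ?_, hC, ?_⟩
    · cases hR
      rfl
    · intro hS c hcI hcS
      obtain ⟨s, hs, he⟩ := Finset.exists_mem_eq_inf S hS (U c)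
      exact ⟨s, hs, he ▸ (hmax c (Finset.mem_sdiff.2 ⟨hcI, hcS⟩)).trans (Finset.inf_le hs)⟩

theorem BuildS.one {n : ℕ} {U : Fin n → Fin n → EReal} {I S R : Finset (Fin n)}
    (h : BuildS U S I 1 R) (hC : (condorcet U I).Nonempty) :
    MaxMinFill U (condorcet U I) I 1 S R := by
  have he : candidates U I = condorcet U I := if_neg hC.ne_empty
  generalize hℓ : (1 : ℕ) = ℓ at h
  cases h with
  | all _ _ _ _ hcard hR =>
    rw [he] at hcard
    have := hC.card_pos
    omega
  | fill _ _ _ _ hcard hR =>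
    rwa [he] at hR

/-- When items are built onto a single item `x`, some item that is at least as optimistic against
`x` as a given potential winner `g` is added. -/
theorem BuildS.exists_ge_of_singleton {n : ℕ} {U : Fin n → Fin n → EReal} {I R : Finset (Fin n)}
    {x g : Fin n} {ℓ : ℕ} (h : BuildS U {x} I ℓ R) (hℓ : 0 < ℓ) (hx : x ∉ I)
    (hg : g ∈ condorcet U I) : ∃ a ∈ I, a ∈ R ∧ U g x ≤ U a x := by
  have he : candidates U I = condorcet U I := if_neg (Finset.ne_empty_of_mem hg)
  have hgI : g ∈ I := (Finset.mem_filter.1 hg).1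
  generalize hS : ({x} : Finset (Fin n)) = S at h
  cases h with
  | all _ _ _ _ hcard hR =>
    subst hS
    refine ⟨g, hgI, ?_, le_rfl⟩
    refine (hR.shape ?_).1 (Finset.mem_union_right _ (he ▸ hg))
    rw [Finset.disjoint_union_left]
    exact ⟨Finset.disjoint_singleton_left.2 fun h => hx (Finset.sdiff_subset h),
      Finset.disjoint_sdiff⟩
  | fill _ _ _ _ hcard hR =>
    subst hS
    cases hR with
    | done => exact absurd hℓ (lt_irrefl 0)
    | pick ℓ _ _ a ha hC hmax hR =>
      refine ⟨a, (Finset.mem_sdiff.1 ha).1, hR.shape.1 (Finset.mem_insert_self _ _), ?_⟩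
      have hgx : g ≠ x := fun h => hx (h ▸ hgI)
      simpa using hmax g (by simp [hgI, hgx])

/-! ### Preferences and confidence bounds -/

theorem pref_self {n : ℕ} (θ : Fin n → ℝ) (hθ : ∀ i, 0 < θ i) (i : Fin n) :
    pref θ i i = 1 / 2 := by
  have := pref_add_pref θ hθ i i
  linarith

theorem pref_congr {n : ℕ} {θ : Fin n → ℝ} {i i' j j' : Fin n} (hi : θ i = θ i')
    (hj : θ j = θ j') : pref θ i j = pref θ i' j' := by
  unfold pref
  rw [hi, hj]

theorem pref_lt_pref {n : ℕ} {θ : Fin n → ℝ} (hθ : ∀ i, 0 < θ i) {i i' : Fin n}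
    (h : θ i < θ i') (j : Fin n) : pref θ i j < pref θ i' j := by
  have := hθ i
  have := hθ i'
  have := hθ j
  unfold pref
  rw [div_lt_div_iff₀ (by linarith) (by linarith)]
  nlinarith

theorem pref_le_pref {n : ℕ} {θ : Fin n → ℝ} (hθ : ∀ i, 0 < θ i) {i i' : Fin n}
    (h : θ i ≤ θ i') (j : Fin n) : pref θ i j ≤ pref θ i' j := by
  rcases h.eq_or_lt with h | h
  · exact (pref_congr h rfl).le
  · exact (pref_lt_pref hθ h j).le

theorem half_lt_pref {n : ℕ} {θ : Fin n → ℝ} (hθ : ∀ i, 0 < θ i) {i j : Fin n}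
    (h : θ j < θ i) : 1 / 2 < pref θ i j := by
  rw [← pref_self θ hθ j]
  exact pref_lt_pref hθ h j

/-- All upper confidence bounds are strictly above the preferences. -/
def Confident {n : ℕ} (θ : Fin n → ℝ) (U : Fin n → Fin n → EReal) : Prop :=
  ∀ i j, i ≠ j → ((pref θ i j : ℝ) : EReal) < U i j

/-- When the confidence bounds hold, the best items of a pool are potential winners. -/
theorem Confident.mem_condorcet {n : ℕ} {θ : Fin n → ℝ} (hθ : ∀ i, 0 < θ i)
    {U : Fin n → Fin n → EReal} (hU : Confident θ U) {I : Finset (Fin n)} {i : Fin n} (hi : i ∈ I)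
    (hmax : ∀ a ∈ I, θ a ≤ θ i) : i ∈ condorcet U I := by
  refine Finset.mem_filter.2 ⟨hi, fun j hj hji => lt_of_le_of_lt ?_ (hU i j hji.symm)⟩
  rw [EReal.coe_le_coe_iff, ← pref_self θ hθ j]
  exact pref_le_pref hθ (hmax j hj) j

/-- The two confidence bounds of a pair that has been compared are symmetric around `1 / 2 + c`
for one and the same confidence radius `c`. -/
theorem exists_ucb_eq {n k : ℕ} {α : ℝ} (hα : 0 ≤ α) (h : History n k) {i j : Fin n} (hij : i ≠ j)
    (h0 : comps h i j ≠ 0) : ∃ x c : ℝ,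
      ucb α (h.length + 1) (wins h) i j = ((x + c : ℝ) : EReal) ∧
      ucb α (h.length + 1) (wins h) j i = ((1 - x + c : ℝ) : EReal) ∧ 0 ≤ c ∧
      comps h i j * c ^ 2 = α * Real.log (h.length + 1 : ℕ) := by
  have hN : (0 : ℝ) < comps h i j := by exact_mod_cast Nat.pos_of_ne_zero h0
  have hL : 0 ≤ Real.log (h.length + 1 : ℕ) := Real.log_natCast_nonneg _
  refine ⟨wins h i j / comps h i j, √(α * Real.log (h.length + 1 : ℕ) / comps h i j), ?_, ?_,
    Real.sqrt_nonneg _, ?_⟩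
  · unfold ucb
    rw [if_neg hij, if_neg (show ¬ wins h i j + wins h j i = 0 from h0)]
    rfl
  · have h1 : wins h j i + wins h i j ≠ 0 := by
      unfold comps at h0
      omega
    have h2 : (1 : ℝ) - wins h i j / comps h i j = wins h j i / comps h i j := by
      rw [eq_div_iff hN.ne', sub_mul, div_mul_cancel₀ _ hN.ne']
      unfold comps
      push_cast
      ring
    unfold ucb
    rw [if_neg hij.symm, if_neg h1, h2, comps_comm]
    rfl
  · rw [Real.sq_sqrt (by positivity)]
    field_simp

theorem comps_le_of_lt_two_mul {N α L c d : ℝ} (hd : 0 < d) (h : d < 2 * c) (hN : 0 ≤ N)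
    (hc : N * c ^ 2 = α * L) : N ≤ 4 * α / d ^ 2 * L := by
  rw [div_mul_eq_mul_div, le_div_iff₀ (by positivity)]
  have : d ^ 2 ≤ (2 * c) ^ 2 := by gcongr
  nlinarith

/-- If the confidence bound of `p_ji` is still above `v`, then the pair has not been compared too
often. -/
theorem comps_le_of_le_ucb {n k : ℕ} {θ : Fin n → ℝ} (hθ : ∀ i, 0 < θ i) {α : ℝ} (hα : 0 ≤ α)
    (h : History n k) {i j : Fin n} (hij : i ≠ j)
    (hU : Confident θ (ucb α (h.length + 1) (wins h))) {v : ℝ} (hv : pref θ j i < v)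
    (hle : (v : EReal) ≤ ucb α (h.length + 1) (wins h) j i) :
    (comps h i j : ℝ) ≤ 4 * α / (v - pref θ j i) ^ 2 * Real.log (h.length + 1 : ℕ) := by
  by_cases h0 : comps h i j = 0
  · rw [h0, Nat.cast_zero]
    have hL : 0 ≤ Real.log (h.length + 1 : ℕ) := Real.log_natCast_nonneg _
    positivity
  · obtain ⟨x, c, h1, h2, hc0, hc⟩ := exists_ucb_eq hα h hij h0
    have h3 := hU i j hij
    rw [h1, EReal.coe_lt_coe_iff] at h3
    rw [h2, EReal.coe_le_coe_iff] at hle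
    have h4 := pref_add_pref θ hθ i j
    exact comps_le_of_lt_two_mul (by linarith) (by linarith) (Nat.cast_nonneg _) hc

/-- If `u_ij ≥ v > 1/2` and `u_ji > 1/2`, then the confidence radius is large, hence the pair has
not been compared too often. -/
theorem comps_le_of_half_lt_ucb {n k : ℕ} {α : ℝ} (hα : 0 ≤ α)
    (h : History n k) {i j : Fin n} (hij : i ≠ j) {v : ℝ} (hv : 1 / 2 < v)
    (hle : (v : EReal) ≤ ucb α (h.length + 1) (wins h) i j)
    (hlt : ((1 / 2 : ℝ) : EReal) < ucb α (h.length + 1) (wins h) j i) :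
    (comps h i j : ℝ) ≤ 4 * α / (v - 1 / 2) ^ 2 * Real.log (h.length + 1 : ℕ) := by
  by_cases h0 : comps h i j = 0
  · rw [h0, Nat.cast_zero]
    have hL : 0 ≤ Real.log (h.length + 1 : ℕ) := Real.log_natCast_nonneg _
    positivity
  · obtain ⟨x, c, h1, h2, hc0, hc⟩ := exists_ucb_eq hα h hij h0
    rw [h1, EReal.coe_le_coe_iff] at hle
    rw [h2, EReal.coe_lt_coe_iff] at hlt
    exact comps_le_of_lt_two_mul (by linarith) (by linarith) (Nat.cast_nonneg _) hc

/-! ### Charged pairs -/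

/-- A pair `i < j` of played items, with `j` worse than `g`, that has been compared at most
`D^g_ij ln t` times. A round in which the slot of `g` holds a worse item can be charged to it. -/
def Charged {n k : ℕ} (θ : Fin n → ℝ) (α : ℝ) (h : History n k) (g : Fin n)
    (R : Finset (Fin n)) : Prop :=
  ∃ i j, i < j ∧ i ∈ R ∧ j ∈ R ∧ θ j < θ g ∧
    (comps h i j : ℝ) ≤ pairComplexity θ α g i j * Real.log (h.length + 1 : ℕ)

theorem Charged.mono {n k : ℕ} {θ : Fin n → ℝ} {α : ℝ} {h : History n k} {g : Fin n}
    {R R' : Finset (Fin n)} (hc : Charged θ α h g R) (hR : R ⊆ R') : Charged θ α h g R' := by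
  obtain ⟨i, j, hij, hi, hj, hc⟩ := hc
  exact ⟨i, j, hij, hR hi, hR hj, hc⟩

theorem lt_of_theta_lt {n : ℕ} {θ : Fin n → ℝ} (hanti : Antitone θ) {i j : Fin n}
    (h : θ j < θ i) : i < j := by
  by_contra hij
  exact absurd h (not_lt.2 (hanti (not_lt.1 hij)))

section charge
variable {n k : ℕ} {θ : Fin n → ℝ} (hθ : ∀ i, 0 < θ i) (hanti : Antitone θ) {α : ℝ} (hα : 0 ≤ α)
  {h : History n k} {g g' : Fin n} {R : Finset (Fin n)}

include hanti in
theorem charged_of_eq {a b : Fin n} (ha : a ∈ R) (hb : b ∈ R) (hag : θ a = θ g) (hbg : θ b < θ g)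
    (hc : (comps h a b : ℝ) ≤ 4 * α / (pref θ g b - 1 / 2) ^ 2 * Real.log (h.length + 1 : ℕ)) :
    Charged θ α h g R := by
  refine ⟨a, b, lt_of_theta_lt hanti (hag ▸ hbg), ha, hb, hbg, ?_⟩
  unfold pairComplexity
  rwa [if_pos hag]

include hanti in
theorem charged_of_gt {a b : Fin n} (ha : a ∈ R) (hb : b ∈ R) (hag : θ g < θ a) (hbg : θ b < θ g)
    (hc : (comps h a b : ℝ) ≤ 4 * α / (pref θ g a - pref θ b a) ^ 2
      * Real.log (h.length + 1 : ℕ)) :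
    Charged θ α h g R := by
  refine ⟨a, b, lt_of_theta_lt hanti (hbg.trans hag), ha, hb, hbg, ?_⟩
  unfold pairComplexity
  rwa [if_neg hag.ne', if_pos hag]

include hθ hα in
theorem charged_of_lt {a b : Fin n} (hab : a ≠ b) (ha : a ∈ R) (hb : b ∈ R) (hag : θ a < θ g)
    (hbg : θ b < θ g)
    (hc : (comps h a b : ℝ) ≤ 4 * α / (pref θ g a - 1 / 2) ^ 2 * Real.log (h.length + 1 : ℕ)) :
    Charged θ α h g R := by
  have hL : 0 ≤ Real.log (h.length + 1 : ℕ) := Real.log_natCast_nonneg _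
  have h1 : 0 < (pref θ g a - 1 / 2) ^ 2 := pow_pos (sub_pos.2 (half_lt_pref hθ hag)) 2
  have h2 : 0 < (pref θ g b - 1 / 2) ^ 2 := pow_pos (sub_pos.2 (half_lt_pref hθ hbg)) 2
  rcases lt_or_gt_of_ne hab with hlt | hlt
  · refine ⟨a, b, hlt, ha, hb, hbg, hc.trans ?_⟩
    unfold pairComplexity
    rw [if_neg hag.ne, if_neg hag.not_gt]
    have h3 := lt_min h1 h2
    gcongr
    exact min_le_left _ _
  · refine ⟨b, a, hlt, hb, ha, hag, comps_comm h a b ▸ hc.trans ?_⟩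
    unfold pairComplexity
    rw [if_neg hbg.ne, if_neg hbg.not_gt]
    have h3 := lt_min h2 h1
    gcongr
    exact min_le_right _ _

include hθ hanti hα in
/-- An item `a` worse than `g` that wins the max-min comparison against a better item `s`. -/
theorem charged_of_ge_of_good (hU : Confident θ (ucb α (h.length + 1) (wins h))) {a s : Fin n}
    (ha : a ∈ R) (hs : s ∈ R) (hg : θ g' = θ g) (hgs : g' ≠ s) (hsg : θ g ≤ θ s) (hag : θ a < θ g)
    (hle : ucb α (h.length + 1) (wins h) g' s ≤ ucb α (h.length + 1) (wins h) a s) :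
    Charged θ α h g R := by
  have hsa : s ≠ a := fun e => absurd (e ▸ hag) (not_lt.2 hsg)
  have hc := comps_le_of_le_ucb hθ hα h hsa hU (pref_lt_pref hθ hag s)
    (pref_congr (j := s) hg rfl ▸ (hU g' s hgs).le.trans hle)
  rcases hsg.eq_or_lt with he | hlt
  · refine charged_of_eq hanti hs ha he.symm hag (hc.trans_eq ?_)
    have h1 : pref θ g s = 1 / 2 := by rw [pref_congr rfl he.symm, pref_self θ hθ]
    have h2 : pref θ a s = 1 - pref θ g a := by
      rw [pref_congr rfl he.symm, ← pref_add_pref θ hθ g a]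
      ring
    rw [h1, h2]
    congr 3
    ring
  · exact charged_of_gt hanti hs ha hlt hag hc

include hθ hanti hα in
/-- An item `a` that wins the max-min comparison against an item `s` worse than `g`, which was a
potential winner of a pool with `a`. -/
theorem charged_of_ge_of_bad (hU : Confident θ (ucb α (h.length + 1) (wins h))) {a s : Fin n}
    (ha : a ∈ R) (hs : s ∈ R) (has : a ≠ s) (hg : θ g' = θ g) (hsg : θ s < θ g) (hag : θ a ≤ θ g)
    (hle : ucb α (h.length + 1) (wins h) g' s ≤ ucb α (h.length + 1) (wins h) a s)
    (hsa : ((1 / 2 : ℝ) : EReal) < ucb α (h.length + 1) (wins h) s a) :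
    Charged θ α h g R := by
  have hgs : g' ≠ s := fun e => hsg.ne (e ▸ hg)
  have hc := comps_le_of_half_lt_ucb hα h has (half_lt_pref hθ hsg)
    (pref_congr (j := s) hg rfl ▸ (hU g' s hgs).le.trans hle) hsa
  rcases hag.eq_or_lt with he | hlt
  · exact charged_of_eq hanti ha hs he hsg hc
  · exact charged_of_lt hθ hα has.symm hs ha hsg hlt (comps_comm h a s ▸ hc)

include hθ hanti hα in
/-- An item as good as `g` that is played together with a worse potential winner `s`. -/
theorem charged_of_half_lt (hU : Confident θ (ucb α (h.length + 1) (wins h))) {a s : Fin n}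
    (ha : a ∈ R) (hs : s ∈ R) (hag : θ a = θ g) (hsg : θ s < θ g)
    (hsa : ((1 / 2 : ℝ) : EReal) < ucb α (h.length + 1) (wins h) s a) :
    Charged θ α h g R := by
  have has : a ≠ s := fun e => hsg.ne (e ▸ hag)
  have h1 : pref θ s a = 1 - pref θ g s := by
    rw [pref_congr rfl hag, ← pref_add_pref θ hθ g s]
    ring
  have h2 := half_lt_pref hθ hsg
  have hc := comps_le_of_le_ucb hθ hα h has hU (v := 1 / 2) (by linarith) hsa.le
  refine charged_of_eq hanti ha hs hag hsg (hc.trans_eq ?_)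
  rw [h1]
  congr 3
  ring

include hθ hanti hα in
/-- A max-min choice among items that are at most as good as `g`, when a worse item `y` has been
kept. -/
theorem charged_of_maxMinFill (hU : Confident θ (ucb α (h.length + 1) (wins h)))
    {C I S : Finset (Fin n)} {y : Fin n} (hd : Disjoint S I)
    (hy : y ∈ S) (hyg : θ y < θ g)
    (hS : ∀ s ∈ S, θ g ≤ θ s ∨ ∀ a ∈ I, ((1 / 2 : ℝ) : EReal) < ucb α (h.length + 1) (wins h) s a)
    (hI : ∀ a ∈ I, θ a ≤ θ g) (hgI : g' ∈ I) (hg : θ g' = θ g)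
    (hf : MaxMinFill (ucb α (h.length + 1) (wins h)) C I 1 S R) : Charged θ α h g R := by
  obtain ⟨a, haI, haS, rfl, -, hmm⟩ := hf.one
  have hgS : g' ∉ S := fun h => Finset.disjoint_left.1 hd h hgI
  obtain ⟨s, hs, hle⟩ := hmm ⟨y, hy⟩ g' hgI hgS
  have haR : a ∈ insert a S := Finset.mem_insert_self a S
  rcases lt_or_ge (θ s) (θ g) with hsg | hsg
  · exact charged_of_ge_of_bad hθ hanti hα hU haR (Finset.mem_insert_of_mem hs)
      (fun e => haS (e ▸ hs)) hg hsg (hI a haI) hle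
      ((hS s hs).resolve_left (not_le.2 hsg) a haI)
  · rcases (hI a haI).eq_or_lt with he | hlt
    · exact charged_of_half_lt hθ hanti hα hU haR (Finset.mem_insert_of_mem hy) he hyg
        ((hS y hy).resolve_left (not_le.2 hyg) a haI)
    · exact charged_of_ge_of_good hθ hanti hα hU haR (Finset.mem_insert_of_mem hs) hg
        (fun e => hgS (e ▸ hs)) hsg hlt hle

include hθ hanti hα in
/-- Once a slot keeps an item `y` worse than the best item left, the round can be charged. -/
theorem SelectSet.charged (hU : Confident θ (ucb α (h.length + 1) (wins h)))
    {B' B : Fin k → Option (Fin n)} {l : Fin k} {I S : Finset (Fin n)}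
    (hs : SelectSet (ucb α (h.length + 1) (wins h)) B' B l I S R) (hd : Disjoint S I)
    (hcard : S.card = l) {y : Fin n} (hy : y ∈ S) (hyg : θ y < θ g)
    (hS : ∀ s ∈ S, θ g ≤ θ s ∨ ∀ a ∈ I, ((1 / 2 : ℝ) : EReal) < ucb α (h.length + 1) (wins h) s a)
    (hI : ∀ a ∈ I, θ a ≤ θ g) (hgI : g' ∈ I) (hg : θ g' = θ g) : Charged θ α h g R := by
  have hne : ∀ I : Finset (Fin n), (∀ a ∈ I, θ a ≤ θ g) → g' ∈ I →
      g' ∈ condorcet (ucb α (h.length + 1) (wins h)) I := fun I hI hgI =>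
    hU.mem_condorcet hθ hgI fun a ha => hg ▸ hI a ha
  induction hs with
  | keep l l' I S R i hl hi hiC hB hR ih =>
    have hiI : i ∈ I := (Finset.mem_filter.1 hiC).1
    have hiS : i ∉ S := fun h => Finset.disjoint_left.1 hd h hiI
    have hd' : Disjoint (insert i S) (I.erase i) := by
      rw [Finset.disjoint_insert_left]
      exact ⟨Finset.notMem_erase i I, hd.mono_right (Finset.erase_subset i I)⟩
    have hcard' : (insert i S).card = l' := by
      rw [Finset.card_insert_of_notMem hiS, hcard, hl]
    rcases (hI i hiI).eq_or_lt with he | hlt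
    · exact (charged_of_half_lt hθ hanti hα hU (Finset.mem_insert_self i S)
        (Finset.mem_insert_of_mem hy) he hyg
        ((hS y hy).resolve_left (not_le.2 hyg) i hiI)).mono (hR.shape hd' hcard').1
    · have hgi : g' ≠ i := fun e => hlt.ne (e ▸ hg)
      refine ih hd' hcard' (Finset.mem_insert_of_mem hy) ?_
        (fun a ha => hI a (Finset.mem_of_mem_erase ha)) (Finset.mem_erase.2 ⟨hgi, hgI⟩)
      intro s hs
      rcases Finset.mem_insert.1 hs with rfl | hs
      · exact Or.inr fun a ha =>
          (Finset.mem_filter.1 hiC).2 a (Finset.mem_of_mem_erase ha) (Finset.ne_of_mem_erase ha)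
      · exact (hS s hs).imp_right fun h a ha => h a (Finset.mem_of_mem_erase ha)
  | refill l I S R x hl hold hC hxI hx hB hrest hR =>
    have hd' : Disjoint (insert x S) (I.erase x) := by
      rw [Finset.disjoint_insert_left]
      exact ⟨Finset.notMem_erase x I, hd.mono_right (Finset.erase_subset x I)⟩
    exact (charged_of_maxMinFill hθ hanti hα hU hd hy hyg hS hI hgI hg (hx.one hC)).mono
      (hR.shape hd').1
  | restart l I S R hl hC hB hrest hR =>
    exact absurd hC (Finset.ne_empty_of_mem (hne I hI hgI))
  | lastUnique l I S i hl hC hB =>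
    have h1 := hne I hI hgI
    rw [hC, Finset.mem_singleton] at h1
    subst h1
    exact charged_of_half_lt hθ hanti hα hU (Finset.mem_insert_self _ S)
      (Finset.mem_insert_of_mem hy) hg hyg ((hS y hy).resolve_left (not_le.2 hyg) _ hgI)
  | lastOther l I S R hl hC hB hR =>
    exact charged_of_maxMinFill hθ hanti hα hU hd hy hyg hS hI hgI hg (hR.one ⟨g', hne I hI hgI⟩)

end charge

/-! ### Slots that hold the best items -/

theorem pred_lt_of_lt {k n : ℕ} (hkn : k < n) : k - 1 < n := (Nat.sub_le k 1).trans_lt hkn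

open Classical in
/-- The items held by the first `L` slots. -/
noncomputable def slotSet {n k : ℕ} (B : Fin k → Option (Fin n)) (L : ℕ) : Finset (Fin n) :=
  Finset.univ.filter fun i => ∃ h : Fin k, h.val < L ∧ B h = some i

/-- Each of the first `L` slots holds an item that is best among those not held by earlier slots. -/
def RightUpTo {n k : ℕ} (θ : Fin n → ℝ) (B : Fin k → Option (Fin n)) (L : ℕ) : Prop :=
  ∀ h : Fin k, h.val < L → ∃ i, B h = some i ∧ i ∉ slotSet B h ∧ ∀ a ∉ slotSet B h, θ a ≤ θ i

section slots
variable {n k : ℕ} {θ : Fin n → ℝ} {B B' : Fin k → Option (Fin n)} {L : ℕ}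

theorem mem_slotSet {i : Fin n} : i ∈ slotSet B L ↔ ∃ h : Fin k, h.val < L ∧ B h = some i := by
  simp [slotSet]

theorem slotSet_zero : slotSet B 0 = ∅ := by
  ext i
  simp [mem_slotSet]

theorem slotSet_succ {h : Fin k} {i : Fin n} (hi : B h = some i) :
    slotSet B (h + 1) = insert i (slotSet B h) := by
  ext a
  rw [Finset.mem_insert, mem_slotSet, mem_slotSet]
  constructor
  · rintro ⟨l, hl, hla⟩
    rcases Nat.lt_succ_iff_lt_or_eq.1 hl with hl | hl
    · exact Or.inr ⟨l, hl, hla⟩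
    · rw [Fin.ext hl, hi] at hla
      exact Or.inl (Option.some_injective _ hla).symm
  · rintro (rfl | ⟨l, hl, hla⟩)
    · exact ⟨h, Nat.lt_succ_self _, hi⟩
    · exact ⟨l, hl.trans (Nat.lt_succ_self _), hla⟩

theorem slotSet_mono {L' : ℕ} (h : L' ≤ L) : slotSet B L' ⊆ slotSet B L := fun i hi => by
  obtain ⟨l, hl, hla⟩ := mem_slotSet.1 hi
  exact mem_slotSet.2 ⟨l, hl.trans_le h, hla⟩

theorem slotSet_congr (h : ∀ l : Fin k, l.val < L → B l = B' l) : slotSet B L = slotSet B' L := by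
  ext i
  rw [mem_slotSet, mem_slotSet]
  exact exists_congr fun l => and_congr_right fun hl => by rw [h l hl]

theorem rightUpTo_zero : RightUpTo θ B 0 := fun _ hh => absurd hh (Nat.not_lt_zero _)

theorem RightUpTo.mono {L' : ℕ} (hr : RightUpTo θ B L) (h : L' ≤ L) : RightUpTo θ B L' :=
  fun l hl => hr l (hl.trans_le h)

theorem RightUpTo.congr (hr : RightUpTo θ B L) (h : ∀ l : Fin k, l.val < L → B' l = B l) :
    RightUpTo θ B' L := fun l hl => by
  rw [h l hl, slotSet_congr fun l' hl' => h l' (hl'.trans hl)]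
  exact hr l hl

theorem RightUpTo.succ (hr : RightUpTo θ B L) {h : Fin k} (hh : h.val = L) {i : Fin n}
    (hi : B h = some i) (hiS : i ∉ slotSet B L) (hmax : ∀ a ∉ slotSet B L, θ a ≤ θ i) :
    RightUpTo θ B (L + 1) := fun l hl => by
  rcases Nat.lt_succ_iff_lt_or_eq.1 hl with hl | hl
  · exact hr l hl
  · obtain rfl : l = h := Fin.ext (hl.trans hh.symm)
    rw [hl]
    exact ⟨i, hi, hiS, hmax⟩

/-- The items of the first `L` slots are at least as good as all the others. -/
theorem RightUpTo.le (hr : RightUpTo θ B L) {s a : Fin n} (hs : s ∈ slotSet B L)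
    (ha : a ∉ slotSet B L) : θ a ≤ θ s := by
  obtain ⟨l, hl, hls⟩ := mem_slotSet.1 hs
  obtain ⟨i, hi, -, hmax⟩ := hr l hl
  rw [hls] at hi
  obtain rfl := Option.some_injective _ hi
  exact hmax a fun h => ha (slotSet_mono hl.le h)

theorem RightUpTo.card (hr : RightUpTo θ B L) (hL : L ≤ k) : (slotSet B L).card = L := by
  induction L with
  | zero => rw [slotSet_zero, Finset.card_empty]
  | succ L ih =>
    obtain ⟨i, hi, hiS, -⟩ := hr ⟨L, hL⟩ (Nat.lt_succ_self L)
    rw [show L + 1 = (⟨L, hL⟩ : Fin k).val + 1 from rfl, slotSet_succ hi,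
      Finset.card_insert_of_notMem hiS]
    congr 1
    exact ih (hr.mono (Nat.le_succ L)) (Nat.le_of_succ_le hL)

/-- The best item outside of a set of `L` items that are at least as good as all the others has the
parameter `θ_{L+1}`. -/
theorem theta_eq_of_top (hanti : Antitone θ) {A : Finset (Fin n)} (hcard : A.card = L) (hL : L < n)
    {i : Fin n} (hi : i ∉ A) (htop : ∀ s ∈ A, θ i ≤ θ s) (hmax : ∀ a ∉ A, θ a ≤ θ i) :
    θ i = θ ⟨L, hL⟩ := by
  apply le_antisymm
  · by_contra hlt
    have hsub : insert i A ⊆ Finset.univ.filter fun a : Fin n => a.val < L := by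
      intro a ha
      have h1 : θ i ≤ θ a := by
        rcases Finset.mem_insert.1 ha with rfl | ha
        · exact le_rfl
        · exact htop a ha
      exact Finset.mem_filter.2 ⟨Finset.mem_univ a,
        lt_of_theta_lt hanti ((not_le.1 hlt).trans_le h1)⟩
    have h2 := Finset.card_le_card hsub
    rw [Finset.card_insert_of_notMem hi, hcard, Fin.card_filter_val_lt] at h2
    have := min_le_right n L
    omega
  · have hne : ¬ (Finset.univ.filter fun a : Fin n => a.val < L + 1) ⊆ A := by
      intro hsub
      have h2 := Finset.card_le_card hsub
      rw [hcard, Fin.card_filter_val_lt, min_eq_right (by omega)] at h2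
      omega
    obtain ⟨a, ha, haA⟩ := Finset.not_subset.1 hne
    have h3 : a.val < L + 1 := by simpa using ha
    exact (hanti (show a ≤ ⟨L, hL⟩ from Nat.lt_succ_iff.1 h3)).trans (hmax a haA)

theorem RightUpTo.theta_eq (hanti : Antitone θ) (hr : RightUpTo θ B L) (hkn : k < n) {s : Fin n}
    (hs : s ∈ slotSet B L) : ∃ g : Fin n, g.val < L ∧ θ s = θ g := by
  obtain ⟨l, hl, hls⟩ := mem_slotSet.1 hs
  obtain ⟨i, hi, hiS, hmax⟩ := hr l hl
  rw [hls] at hi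
  obtain rfl := Option.some_injective _ hi
  have hr' := hr.mono hl.le
  exact ⟨⟨l, l.2.trans hkn⟩, hl, theta_eq_of_top hanti (hr'.card l.2.le) (l.2.trans hkn) hiS
    (fun a ha => hr'.le ha hiS) hmax⟩

theorem RightUpTo.exists_best (hanti : Antitone θ) (hr : RightUpTo θ B L) (hL : L ≤ k)
    (hLn : L < n) :
    ∃ g ∉ slotSet B L, θ g = θ ⟨L, hLn⟩ ∧ ∀ a ∉ slotSet B L, θ a ≤ θ g := by
  have hne : (slotSet B L)ᶜ.Nonempty := by
    rw [← Finset.card_pos, Finset.card_compl, hr.card hL, Fintype.card_fin]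
    omega
  obtain ⟨g, hg, hmax⟩ := Finset.exists_max_image _ θ hne
  rw [Finset.mem_compl] at hg
  have hmax' : ∀ a ∉ slotSet B L, θ a ≤ θ g := fun a ha => hmax a (Finset.mem_compl.2 ha)
  exact ⟨g, hg, theta_eq_of_top hanti (hr.card hL) hLn hg (fun s hs => hr.le hs hg) hmax', hmax'⟩

theorem sum_val_lt_succ (hL : L < n) :
    ∑ a : Fin n with a.val < L + 1, θ a = θ ⟨L, hL⟩ + ∑ a : Fin n with a.val < L, θ a := by
  have h1 : (Finset.univ.filter fun a : Fin n => a.val < L + 1) =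
      insert ⟨L, hL⟩ (Finset.univ.filter fun a : Fin n => a.val < L) := by
    ext a
    simp [Fin.ext_iff]
    omega
  rw [h1, Finset.sum_insert (by simp)]

theorem RightUpTo.sum (hanti : Antitone θ) (hr : RightUpTo θ B L) (hL : L ≤ k) (hkn : k < n) :
    ∑ a ∈ slotSet B L, θ a = ∑ a : Fin n with a.val < L, θ a := by
  induction L with
  | zero => simp [slotSet_zero]
  | succ L ih =>
    obtain ⟨i, hi, hiS, hmax⟩ := hr ⟨L, hL⟩ (Nat.lt_succ_self L)
    have hr' := hr.mono (Nat.le_succ L)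
    rw [show L + 1 = (⟨L, hL⟩ : Fin k).val + 1 from rfl, slotSet_succ hi,
      Finset.sum_insert hiS]
    change θ i + ∑ a ∈ slotSet B L, θ a = ∑ a : Fin n with a.val < L + 1, θ a
    rw [sum_val_lt_succ (by omega), ih hr' (Nat.le_of_succ_le hL),
      theta_eq_of_top hanti (hr'.card (Nat.le_of_succ_le hL)) (by omega) hiS
        (fun s hs => hr'.le hs hiS) hmax]

end slots

/-- A slot that holds a potential winner of the pool is kept. -/
theorem SelectSet.of_mem_condorcet {n k : ℕ} {U : Fin n → Fin n → EReal}
    {B' B : Fin k → Option (Fin n)} {h : Fin k} {I S R : Finset (Fin n)} {i : Fin n}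
    (hs : SelectSet U B' B h I S R) (hk : h.val + 1 < k) (hi : B' h = some i)
    (hiC : i ∈ condorcet U I) :
    B h = some i ∧ SelectSet U B' B ⟨h.val + 1, hk⟩ (I.erase i) (insert i S) R := by
  cases hs with
  | keep _ h' _ _ _ a hh ha haC hB hR =>
    rw [hi] at ha
    obtain rfl := Option.some_injective _ ha
    obtain rfl : h' = ⟨h.val + 1, hk⟩ := Fin.ext hh
    exact ⟨hB, hR⟩
  | refill _ _ _ _ x hh hold => exact absurd hiC (hold i hi)
  | restart _ _ _ _ hh hC => exact absurd hC (Finset.ne_empty_of_mem hiC)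
  | lastUnique _ _ _ a hh => omega
  | lastOther _ _ _ _ hh => omega

section move
variable {n k : ℕ} {θ : Fin n → ℝ} (hθ : ∀ i, 0 < θ i) (hanti : Antitone θ)

include hθ in
/-- When the confidence bounds hold, the algorithm passes the slots that hold the right items. -/
theorem SelectSet.advance {U : Fin n → Fin n → EReal} (hU : Confident θ U)
    {B' B : Fin k → Option (Fin n)} {h₀ : Fin k} (h0 : h₀.val = 0) {R : Finset (Fin n)}
    (hs : SelectSet U B' B h₀ Finset.univ ∅ R) {L : ℕ} (hL : L < k) (hr : RightUpTo θ B' L) :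
    (∀ l : Fin k, l.val < L → B l = B' l) ∧
      SelectSet U B' B ⟨L, hL⟩ (slotSet B' L)ᶜ (slotSet B' L) R := by
  induction L with
  | zero =>
    refine ⟨fun l hl => absurd hl (Nat.not_lt_zero _), ?_⟩
    obtain rfl : h₀ = ⟨0, hL⟩ := Fin.ext h0
    rwa [slotSet_zero, Finset.compl_empty]
  | succ L ih =>
    obtain ⟨h1, h2⟩ := ih (Nat.lt_of_succ_lt hL) (hr.mono (Nat.le_succ L))
    obtain ⟨i, hi, hiS, hmax⟩ := hr ⟨L, Nat.lt_of_succ_lt hL⟩ (Nat.lt_succ_self L)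
    have hiC : i ∈ condorcet U (slotSet B' L)ᶜ :=
      hU.mem_condorcet hθ (Finset.mem_compl.2 hiS) fun a ha => hmax a (Finset.mem_compl.1 ha)
    obtain ⟨h3, h4⟩ := h2.of_mem_condorcet hL hi hiC
    have h5 : slotSet B' (L + 1) = insert i (slotSet B' L) := slotSet_succ hi
    refine ⟨fun l hl => ?_, ?_⟩
    · rcases Nat.lt_succ_iff_lt_or_eq.1 hl with hl | hl
      · exact h1 l hl
      · obtain rfl : l = ⟨L, Nat.lt_of_succ_lt hL⟩ := Fin.ext hl
        rw [h3, hi]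
    · rw [h5, Finset.compl_insert]
      exact h4

include hθ hanti in
/-- If the first `L` slots hold the right items, then the next slot gets its right item as well or
the round can be charged. -/
theorem LegalMove.progress {α : ℝ} (hα : 0 ≤ α) {h : History n k} {B : Fin k → Option (Fin n)}
    {R : Finset (Fin n)} (hU : Confident θ (ucb α (h.length + 1) (wins h)))
    (hm : LegalMove α h B R) {L : ℕ} (hL : L + 1 < k) (hkn : k < n)
    (hr : RightUpTo θ (lastSlots h) L) :
    RightUpTo θ B (L + 1) ∨ Charged θ α h ⟨L, by omega⟩ R := by
  have hLk : L ≤ k := by omega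
  obtain ⟨h₀, h0, hs⟩ := hm
  obtain ⟨hBB, hs⟩ := hs.advance hθ hU h0 (by omega) hr
  obtain ⟨g', hg'S, hg', hmax⟩ := hr.exists_best hanti hLk (by omega)
  have hrB : RightUpTo θ B L := hr.congr hBB
  have hBs : slotSet B L = slotSet (lastSlots h) L := slotSet_congr hBB
  have hmax' : ∀ a ∉ slotSet (lastSlots h) L, θ a ≤ θ ⟨L, by omega⟩ := fun a ha => hg' ▸ hmax a ha
  have hgood : ∀ i, B ⟨L, by omega⟩ = some i → i ∉ slotSet (lastSlots h) L →
      θ i = θ ⟨L, by omega⟩ → RightUpTo θ B (L + 1) := by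
    intro i hi hiS hiθ
    refine hrB.succ (h := ⟨L, by omega⟩) rfl hi (hBs ▸ hiS) fun a ha => ?_
    rw [hiθ]
    exact hmax' a (hBs ▸ ha)
  generalize hI : (slotSet (lastSlots h) L)ᶜ = I at hs
  generalize hSdef : slotSet (lastSlots h) L = S at hs hg'S hmax' hgood
  have hII : ∀ a, a ∈ I ↔ a ∉ S := fun a => by rw [← hI, ← hSdef, Finset.mem_compl]
  have hd : Disjoint S I := Finset.disjoint_left.2 fun a ha haI => (hII a).1 haI ha
  have hScard : S.card = L := hSdef ▸ hr.card hLk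
  have hSg : ∀ s ∈ S, θ ⟨L, by omega⟩ ≤ θ s := fun s hs =>
    hg' ▸ hr.le (hSdef ▸ hs) (hSdef ▸ hg'S)
  have hgI : g' ∈ I := (hII g').2 hg'S
  cases hs with
  | keep _ l' _ _ _ i hl hi hiC hB hR =>
    have hiI : i ∈ I := (Finset.mem_filter.1 hiC).1
    have hiS : i ∉ S := (hII i).1 hiI
    rcases (hmax' i hiS).eq_or_lt with he | hlt
    · exact Or.inl (hgood i hB hiS he)
    · right
      refine hR.charged hθ hanti hα hU (y := i) (g' := g') ?_ ?_ (Finset.mem_insert_self i S) hlt ?_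
        (fun a ha => hmax' a ((hII a).1 (Finset.mem_of_mem_erase ha)))
        (Finset.mem_erase.2 ⟨fun e => hlt.ne (e ▸ hg'), hgI⟩) hg'
      · rw [Finset.disjoint_insert_left]
        exact ⟨Finset.notMem_erase i I, hd.mono_right (Finset.erase_subset i I)⟩
      · rw [Finset.card_insert_of_notMem hiS, hScard, hl]
      · intro s hs
        rcases Finset.mem_insert.1 hs with rfl | hs
        · exact Or.inr fun a ha =>
            (Finset.mem_filter.1 hiC).2 a (Finset.mem_of_mem_erase ha) (Finset.ne_of_mem_erase ha)
        · exact Or.inl (hSg s hs)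
  | refill _ _ _ _ x hl hold hC hxI hx hB hrest hR =>
    have hxS : x ∉ S := (hII x).1 hxI
    rcases (hmax' x hxS).eq_or_lt with he | hlt
    · exact Or.inl (hgood x hB hxS he)
    · right
      have hgx : g' ≠ x := fun e => hlt.ne (e ▸ hg')
      have hsub := (hR.shape (by
        rw [Finset.disjoint_insert_left]
        exact ⟨Finset.notMem_erase x I, hd.mono_right (Finset.erase_subset x I)⟩)).1
      have hxR : x ∈ R := hsub (Finset.mem_insert_self x S)
      obtain ⟨a, haI, haS, hins, hemp, hmm⟩ := (hx.one hC).one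
      have hax : x = a := by
        have h1 : x ∈ insert a S := hins ▸ Finset.mem_insert_self x S
        exact (Finset.mem_insert.1 h1).resolve_right hxS
      subst hax
      rcases S.eq_empty_or_nonempty with hSe | hSne
      · have hxC := hemp hSe
        subst hSe
        have hgC : g' ∈ condorcet (ucb α (h.length + 1) (wins h)) (I.erase x) :=
          hU.mem_condorcet hθ (Finset.mem_erase.2 ⟨hgx, hgI⟩) fun a ha =>
            hg' ▸ hmax' a (Finset.notMem_empty a)
        -- The potential winner `x` is the only item so far, so the max-min rule compares against it.
        obtain ⟨a, ha, haR, hle⟩ := BuildS.exists_ge_of_singleton (x := x)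
          (U := ucb α (h.length + 1) (wins h)) hR (by simp; omega) (Finset.notMem_erase x I) hgC
        exact charged_of_ge_of_bad hθ hanti hα hU haR hxR (Finset.ne_of_mem_erase ha) hg' hlt
          (hmax' a (Finset.notMem_empty a)) hle
          ((Finset.mem_filter.1 hxC).2 a (Finset.mem_of_mem_erase ha) (Finset.ne_of_mem_erase ha))
      · obtain ⟨s, hs, hle⟩ := hmm hSne g' hgI hg'S
        exact charged_of_ge_of_good hθ hanti hα hU hxR (hsub (Finset.mem_insert_of_mem hs)) hg'
          (fun e => hg'S (e ▸ hs)) (hSg s hs) hlt hle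
  | restart _ _ _ _ hl hC =>
    exact absurd hC (Finset.ne_empty_of_mem (hU.mem_condorcet hθ hgI fun a ha =>
      hg' ▸ hmax' a ((hII a).1 ha)))
  | lastUnique _ _ _ _ hl =>
    simp only at hl
    omega
  | lastOther _ _ _ _ hl =>
    simp only at hl
    omega

include hθ in
theorem LegalMove.rightUpTo {α : ℝ} {h : History n k} {B : Fin k → Option (Fin n)}
    {R : Finset (Fin n)} (hU : Confident θ (ucb α (h.length + 1) (wins h)))
    (hm : LegalMove α h B R) {L : ℕ} (hL : L < k) (hr : RightUpTo θ (lastSlots h) L) :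
    RightUpTo θ B L ∧ slotSet B L = slotSet (lastSlots h) L := by
  obtain ⟨h₀, h0, hs⟩ := hm
  obtain ⟨hBB, hs⟩ := hs.advance hθ hU h0 hL hr
  exact ⟨hr.congr hBB, slotSet_congr hBB⟩

include hθ hanti in
/-- If all slots but the last one hold the right items, then these items are played together with
one more item, which is as good as the item of rank `k` or a max-min choice that has not been
compared often with one of the items in the slots. -/
theorem LegalMove.saturated {α : ℝ} (hα : 0 ≤ α) {h : History n k} {B : Fin k → Option (Fin n)}
    {R : Finset (Fin n)} (hU : Confident θ (ucb α (h.length + 1) (wins h)))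
    (hm : LegalMove α h B R) (hk : 2 ≤ k) (hkn : k < n)
    (hr : RightUpTo θ (lastSlots h) (k - 1)) :
    ∃ b ∉ slotSet (lastSlots h) (k - 1), R = insert b (slotSet (lastSlots h) (k - 1)) ∧
      (θ b = θ ⟨k - 1, pred_lt_of_lt hkn⟩ ∨ θ b < θ ⟨k - 1, pred_lt_of_lt hkn⟩ ∧
        ∃ s ∈ slotSet (lastSlots h) (k - 1), (comps h b s : ℝ) ≤
          4 * α / (pref θ ⟨k - 1, pred_lt_of_lt hkn⟩ s - pref θ b s) ^ 2
            * Real.log (h.length + 1 : ℕ)) := by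
  obtain ⟨h₀, h0, hs⟩ := hm
  obtain ⟨hBB, hs⟩ := hs.advance hθ hU h0 (by omega) hr
  obtain ⟨g', hg'S, hg', hmax⟩ := hr.exists_best hanti (by omega) (by omega)
  have hcard := hr.card (by omega)
  generalize hI : (slotSet (lastSlots h) (k - 1))ᶜ = I at hs
  generalize hSdef : slotSet (lastSlots h) (k - 1) = S at hs hg'S hmax hcard ⊢
  have hII : ∀ a, a ∈ I ↔ a ∉ S := fun a => by rw [← hI, ← hSdef, Finset.mem_compl]
  have hgI : g' ∈ I := (hII g').2 hg'S
  have hgC : g' ∈ condorcet (ucb α (h.length + 1) (wins h)) I :=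
    hU.mem_condorcet hθ hgI fun a ha => hmax a ((hII a).1 ha)
  have hSne : S.Nonempty := Finset.card_pos.1 (by omega)
  cases hs with
  | keep _ l' _ _ _ i hl =>
    have := l'.2
    simp only at hl
    omega
  | refill _ _ _ _ x hl =>
    simp only at hl
    omega
  | restart _ _ _ _ hl =>
    simp only at hl
    omega
  | lastUnique _ _ _ i hl hC =>
    rw [hC, Finset.mem_singleton] at hgC
    subst hgC
    exact ⟨g', hg'S, rfl, Or.inl hg'⟩
  | lastOther _ _ _ _ hl hC hB hR =>
    obtain ⟨b, hbI, hbS, rfl, -, hmm⟩ := (hR.one ⟨g', hgC⟩).one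
    refine ⟨b, hbS, rfl, ?_⟩
    rcases ((hmax b hbS).trans_eq hg').eq_or_lt with he | hlt
    · exact Or.inl he
    · right
      obtain ⟨s, hs, hle⟩ := hmm hSne g' hgI hg'S
      refine ⟨hlt, s, hs, ?_⟩
      have hsb : s ≠ b := fun e => hbS (e ▸ hs)
      have hgs : g' ≠ s := fun e => hg'S (e ▸ hs)
      rw [comps_comm]
      exact comps_le_of_le_ucb hθ hα h hsb hU (pref_lt_pref hθ hlt s)
        (pref_congr (j := s) hg' rfl ▸ (hU g' s hgs).le.trans hle)

end move

/-! ### Counting rounds -/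

/-- A history that the algorithm can produce: all moves are legal, and each ranking lists the set
that was played. -/
def IsRun {n k : ℕ} (α : ℝ) : History n k → Prop
  | [] => True
  | r :: h => LegalMove α h r.slots r.played ∧ (∀ i, i ∈ r.ranking ↔ i ∈ r.played) ∧ IsRun α h

theorem runLaw_isRun {n k : ℕ} (θ : Fin n → ℝ) (hθ : ∀ i, 0 < θ i) {α : ℝ} {rule : Rule n k}
    (hrule : IsRecMaxMinUCB α rule) (T : ℕ) (h : History n k)
    (hh : h ∈ (runLaw θ hθ rule T).support) : IsRun α h := by
  induction T generalizing h with
  | zero =>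
    simp only [runLaw, PMF.mem_support_pure_iff] at hh
    rw [hh]
    trivial
  | succ T ih =>
    unfold runLaw at hh
    rw [PMF.mem_support_bind_iff] at hh
    obtain ⟨h', hh', hh⟩ := hh
    rw [PMF.mem_support_bind_iff] at hh
    obtain ⟨m, hm, hh⟩ := hh
    rw [PMF.mem_support_map_iff] at hh
    obtain ⟨σ, hσ, rfl⟩ := hh
    have hl := hrule h' m hm
    exact ⟨hl, topRanking_support θ hθ k m.2 hl.card.le σ hσ, ih h' hh'⟩

/-- The round after the history `h` is bad if it is one of the first `f` rounds, or if some slot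
other than the last one does not hold its right item at the start. -/
def Bad {n k : ℕ} (θ : Fin n → ℝ) (f : ℝ) (h : History n k) : Prop :=
  ((h.length + 1 : ℕ) : ℝ) ≤ f ∨ ¬ RightUpTo θ (lastSlots h) (k - 1)

open Classical in
/-- The number of bad rounds. -/
noncomputable def badCount {n k : ℕ} (θ : Fin n → ℝ) (f : ℝ) : History n k → ℕ
  | [] => 0
  | _ :: h => badCount θ f h + if Bad θ f h then 1 else 0

open Classical in
/-- The number of rounds in which `i` and `j` are played after at most `D ln t` comparisons. -/
noncomputable def chargeCount {n k : ℕ} (D : ℝ) (i j : Fin n) : History n k → ℕ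
  | [] => 0
  | r :: h => chargeCount D i j h + if i ∈ r.played ∧ j ∈ r.played ∧
      (comps h i j : ℝ) ≤ D * Real.log (h.length + 1 : ℕ) then 1 else 0

open Classical in
/-- The number of rounds that are not bad and in which `b` is played. -/
noncomputable def saturatedCount {n k : ℕ} (θ : Fin n → ℝ) (f : ℝ) (b : Fin n) : History n k → ℕ
  | [] => 0
  | r :: h => saturatedCount θ f b h + if ¬ Bad θ f h ∧ b ∈ r.played then 1 else 0

open Classical in
/-- The number of initial segments of the slots, without the last slot, that hold the right
items. -/
noncomputable def level {n k : ℕ} (θ : Fin n → ℝ) (B : Fin k → Option (Fin n)) : ℕ :=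
  ((Finset.Icc 1 (k - 1)).filter fun L => RightUpTo θ B L).card

theorem mul_log_le_mul_log_succ {D : ℝ} (hD : 0 ≤ D) (m : ℕ) :
    D * Real.log (m : ℕ) ≤ D * Real.log (m + 1 : ℕ) := by
  rcases Nat.eq_zero_or_pos m with rfl | hm
  · simp
  · have : (0 : ℝ) < m := by exact_mod_cast hm
    have := Real.log_le_log this (by push_cast; linarith : (m : ℝ) ≤ (m + 1 : ℕ))
    gcongr

theorem chargeCount_le_comps {n k : ℕ} {α : ℝ} (D : ℝ) {i j : Fin n} (hij : i ≠ j)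
    {h : History n k} (hrun : IsRun α h) : chargeCount D i j h ≤ comps h i j := by
  induction h with
  | nil => simp [chargeCount]
  | cons r h ih =>
    have := ih hrun.2.2
    rw [comps_cons hrun.2.1 h hij]
    unfold chargeCount
    split_ifs with h1 h2 h2
    · omega
    · exact absurd ⟨h1.1, h1.2.1⟩ h2
    · omega
    · omega

theorem chargeCount_le {n k : ℕ} {α D : ℝ} (hD : 0 ≤ D) {i j : Fin n} (hij : i ≠ j)
    {h : History n k} (hrun : IsRun α h) :
    (chargeCount D i j h : ℝ) ≤ D * Real.log h.length + 1 := by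
  induction h with
  | nil => simp [chargeCount]
  | cons r h ih =>
    have h1 := ih hrun.2.2
    have h2 : (chargeCount D i j h : ℝ) ≤ comps h i j := by
      exact_mod_cast chargeCount_le_comps D hij hrun.2.2
    have h3 := mul_log_le_mul_log_succ hD h.length
    unfold chargeCount
    rw [List.length_cons]
    split_ifs with hc
    · push_cast at *
      linarith [hc.2.2]
    · push_cast at *
      linarith

theorem badCount_add_saturatedCount_le {n k : ℕ} (θ : Fin n → ℝ) (f : ℝ) (b : Fin n)
    (h : History n k) : badCount θ f h + saturatedCount θ f b h ≤ h.length := by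
  induction h with
  | nil => simp [badCount, saturatedCount]
  | cons r h ih =>
    unfold badCount saturatedCount
    rw [List.length_cons]
    by_cases hb : Bad θ f h
    · rw [if_pos hb, if_neg fun hc => hc.1 hb]
      omega
    · rw [if_neg hb]
      split_ifs <;> omega

theorem badCount_cons_of_bad {n k : ℕ} {θ : Fin n → ℝ} {f : ℝ} (r : Round n k) {h : History n k}
    (hb : Bad θ f h) : badCount θ f (r :: h) = badCount θ f h + 1 := by
  rw [badCount, if_pos hb]

theorem badCount_cons_of_not_bad {n k : ℕ} {θ : Fin n → ℝ} {f : ℝ} (r : Round n k)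
    {h : History n k} (hb : ¬ Bad θ f h) : badCount θ f (r :: h) = badCount θ f h := by
  rw [badCount, if_neg hb, add_zero]

theorem badCount_eq_of_length_le {n k : ℕ} (θ : Fin n → ℝ) (f : ℝ) (h : History n k)
    (hf : (h.length : ℝ) ≤ f) : badCount θ f h = h.length := by
  induction h with
  | nil => rfl
  | cons r h ih =>
    rw [List.length_cons] at hf ⊢
    rw [badCount_cons_of_bad r (Or.inl hf), ih (le_trans (by push_cast; linarith) hf)]

theorem confident_of_lt {n k : ℕ} {θ : Fin n → ℝ} {α f : ℝ} {r : Round n k} {h : History n k}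
    (hc : ConfidentAfter θ α f (r :: h)) (hf : f < (h.length + 1 : ℕ)) :
    Confident θ (ucb α (h.length + 1) (wins h)) := hc.1 hf

section count
variable {n k : ℕ} {θ : Fin n → ℝ} (hθ : ∀ i, 0 < θ i) (hanti : Antitone θ) {α f : ℝ}
  (hα : 1 / 2 < α) (hk : 2 ≤ k) (hkn : k < n)

include hθ hk in
/-- As long as some slot does not hold its right item, all rounds so far have been bad. -/
theorem badCount_eq_length {h : History n k} (hrun : IsRun α h) (hc : ConfidentAfter θ α f h)
    (hr : ¬ RightUpTo θ (lastSlots h) (k - 1)) : badCount θ f h = h.length := by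
  induction h with
  | nil => rfl
  | cons r h ih =>
    rcases le_or_gt ((h.length + 1 : ℕ) : ℝ) f with hf | hf
    · exact badCount_eq_of_length_le θ f _ hf
    · have hr' : ¬ RightUpTo θ (lastSlots h) (k - 1) := fun hr' =>
        hr (hrun.1.rightUpTo hθ (confident_of_lt hc hf) (by omega) hr').1
      rw [badCount_cons_of_bad r (Or.inr hr'), ih hrun.2.2 hc.2 hr', List.length_cons]

include hθ hk in
theorem saturatedCount_eq_zero {h : History n k} (hrun : IsRun α h) (hc : ConfidentAfter θ α f h)
    (b : Fin n) (hb : Bad θ f h) : saturatedCount θ f b h = 0 := by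
  have h1 := badCount_add_saturatedCount_le θ f b h
  have h2 : badCount θ f h = h.length := by
    rcases hb with hb | hb
    · exact badCount_eq_of_length_le θ f h (le_trans (by push_cast; linarith) hb)
    · exact badCount_eq_length hθ hk hrun hc hb
  omega

open Classical in
/-- The triples `(g, j, i)` over which the total complexity is summed. -/
noncomputable def complexityIndex (θ : Fin n → ℝ) (k : ℕ) :
    Finset (Σ _ : Fin n, Σ _ : Fin n, Fin n) :=
  (Finset.univ.filter fun g : Fin n => g.val < k).sigma fun g =>
    (Finset.univ.filter fun j : Fin n => θ j < θ g).sigma fun j =>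
      Finset.univ.filter fun i : Fin n => i < j

theorem mem_complexityIndex {x : Σ _ : Fin n, Σ _ : Fin n, Fin n} :
    x ∈ complexityIndex θ k ↔ x.1.val < k ∧ θ x.2.1 < θ x.1 ∧ x.2.2 < x.2.1 := by
  simp [complexityIndex]

theorem totalComplexity_eq : totalComplexity θ α k =
    ∑ x ∈ complexityIndex θ k, pairComplexity θ α x.1 x.2.2 x.2.1 := by
  unfold totalComplexity itemComplexity complexityIndex
  rw [Finset.sum_sigma]
  refine Finset.sum_congr rfl fun g _ => ?_
  rw [Finset.sum_sigma]

include hθ hα in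
/-- All gaps between preferences are less than `1 / 2`, hence `D^g_ij ≥ 16 α ≥ 8`. -/
theorem eight_le_pairComplexity {g i j : Fin n} (hj : θ j < θ g) :
    8 ≤ pairComplexity θ α g i j := by
  have key : ∀ d : ℝ, 0 < d → d ≤ 1 / 4 → 8 ≤ 4 * α / d := fun d h0 h1 => by
    rw [le_div_iff₀ h0]
    linarith
  have hsq : ∀ d : ℝ, 0 < d → d < 1 / 2 → 0 < d ^ 2 ∧ d ^ 2 ≤ 1 / 4 := fun d h0 h1 =>
    ⟨by positivity, by nlinarith⟩
  have hp : ∀ a b : Fin n, pref θ a b < 1 := fun a b => by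
    have := pref_add_pref θ hθ a b
    have := pref_pos θ hθ b a
    linarith
  have hgj := half_lt_pref hθ hj
  have h1 := hsq (pref θ g j - 1 / 2) (by linarith) (by linarith [hp g j])
  unfold pairComplexity
  split_ifs with he hlt
  · exact key _ h1.1 h1.2
  · have h2 := pref_lt_pref hθ hj i
    have h3 := half_lt_pref hθ hlt
    have h4 := pref_add_pref θ hθ g i
    have h5 := hsq (pref θ g i - pref θ j i) (by linarith) (by linarith [pref_pos θ hθ j i])
    exact key _ h5.1 h5.2
  · have hi : θ i < θ g := lt_of_le_of_ne (not_lt.1 hlt) he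
    have h2 := hsq (pref θ g i - 1 / 2) (by linarith [half_lt_pref hθ hi])
      (by linarith [hp g i])
    exact key _ (lt_min h2.1 h1.1) ((min_le_right _ _).trans h1.2)

include hθ hanti hα hk in
theorem le_totalComplexity (hgap : θ ⟨k, hkn⟩ < θ ⟨k - 1, pred_lt_of_lt hkn⟩) :
    8 * ((n : ℝ) - 1) ≤ totalComplexity θ α k := by
  rw [totalComplexity_eq]
  let F : Fin (n - 1) → Σ _ : Fin n, Σ _ : Fin n, Fin n := fun i =>
    ⟨⟨0, Nat.zero_lt_of_lt hkn⟩, ⟨n - 1, by omega⟩, ⟨i.val, by omega⟩⟩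
  have hF : Function.Injective F := fun a b hab => by
    simp only [F, Sigma.mk.injEq, heq_eq_eq, true_and, Fin.mk.injEq] at hab
    exact Fin.ext hab
  have hlast : θ ⟨n - 1, by omega⟩ < θ ⟨0, Nat.zero_lt_of_lt hkn⟩ := by
    have h1 : θ ⟨n - 1, by omega⟩ ≤ θ ⟨k, hkn⟩ := hanti (by
      rw [Fin.le_def]
      simp only
      omega)
    have h2 : θ ⟨k - 1, pred_lt_of_lt hkn⟩ ≤ θ ⟨0, Nat.zero_lt_of_lt hkn⟩ := hanti (by
      rw [Fin.le_def]
      simp only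
      omega)
    linarith
  have hsub : Finset.univ.map ⟨F, hF⟩ ⊆ complexityIndex θ k := by
    intro x hx
    obtain ⟨i, -, rfl⟩ := Finset.mem_map.1 hx
    rw [mem_complexityIndex]
    refine ⟨by simp only [F, Function.Embedding.coeFn_mk]; omega, hlast, ?_⟩
    have := i.2
    simp only [F, Function.Embedding.coeFn_mk, Fin.lt_def]
    omega
  have h8 : ∀ x ∈ complexityIndex θ k, 8 ≤ pairComplexity θ α x.1 x.2.2 x.2.1 := fun x hx =>
    eight_le_pairComplexity hθ hα (mem_complexityIndex.1 hx).2.1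
  have hcard := Finset.card_le_card hsub
  rw [Finset.card_map, Finset.card_univ, Fintype.card_fin] at hcard
  have h1 := Finset.card_nsmul_le_sum _ _ _ h8
  rw [nsmul_eq_mul] at h1
  have h2 : ((n : ℝ) - 1) ≤ ((complexityIndex θ k).card : ℝ) := by
    rw [← Nat.cast_one, ← Nat.cast_sub (by omega)]
    exact_mod_cast hcard
  linarith

theorem level_le (B : Fin k → Option (Fin n)) : level θ B ≤ k - 1 := by
  classical
  unfold level
  refine (Finset.card_filter_le _ _).trans ?_
  simp

include hθ in
theorem level_mono {h : History n k} {B : Fin k → Option (Fin n)} {R : Finset (Fin n)}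
    (hU : Confident θ (ucb α (h.length + 1) (wins h))) (hm : LegalMove α h B R) :
    level θ (lastSlots h) ≤ level θ B := by
  classical
  refine Finset.card_le_card fun L hL => ?_
  rw [Finset.mem_filter] at hL ⊢
  have := Finset.mem_Icc.1 hL.1
  exact ⟨hL.1, (hm.rightUpTo hθ hU (by omega) hL.2).1⟩

include hθ in
theorem level_lt {h : History n k} {B : Fin k → Option (Fin n)} {R : Finset (Fin n)}
    (hU : Confident θ (ucb α (h.length + 1) (wins h))) (hm : LegalMove α h B R) {L : ℕ}
    (hL : L + 1 < k) (h1 : ¬ RightUpTo θ (lastSlots h) (L + 1)) (h2 : RightUpTo θ B (L + 1)) :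
    level θ (lastSlots h) < level θ B := by
  classical
  refine Finset.card_lt_card (Finset.ssubset_iff_of_subset ?_ |>.2 ⟨L + 1, ?_, ?_⟩)
  · intro L hL
    rw [Finset.mem_filter] at hL ⊢
    have := Finset.mem_Icc.1 hL.1
    exact ⟨hL.1, (hm.rightUpTo hθ hU (by omega) hL.2).1⟩
  · rw [Finset.mem_filter, Finset.mem_Icc]
    exact ⟨by omega, h2⟩
  · rw [Finset.mem_filter]
    exact fun h => h1 h.2

/-- If not all of the first `M` slots are right, then there is a first one that is not. -/
theorem exists_first_wrong {B : Fin k → Option (Fin n)} {M : ℕ} (hr : ¬ RightUpTo θ B M) :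
    ∃ L, L < M ∧ RightUpTo θ B L ∧ ¬ RightUpTo θ B (L + 1) := by
  induction M with
  | zero => exact absurd rightUpTo_zero hr
  | succ M ih =>
    by_cases h : RightUpTo θ B M
    · exact ⟨M, Nat.lt_succ_self M, h, hr⟩
    · obtain ⟨L, hL, h⟩ := ih h
      exact ⟨L, hL.trans (Nat.lt_succ_self M), h⟩

include hθ hanti hα hkn in
/-- Each bad round is one of the first `f` rounds, is charged to a pair, or raises the level. -/
theorem badCount_le (hf : 0 ≤ f) {h : History n k} (hrun : IsRun α h)
    (hc : ConfidentAfter θ α f h) :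
    (badCount θ f h : ℝ) ≤ f + (∑ x ∈ complexityIndex θ k,
      chargeCount (pairComplexity θ α x.1 x.2.2 x.2.1) x.2.2 x.2.1 h : ℕ)
        + level θ (lastSlots h) := by
  induction h with
  | nil =>
    simp only [badCount, Nat.cast_zero]
    positivity
  | cons r h ih =>
    have h1 := ih hrun.2.2 hc.2
    have h2 : ∀ x ∈ complexityIndex θ k,
        chargeCount (pairComplexity θ α x.1 x.2.2 x.2.1) x.2.2 x.2.1 h ≤
        chargeCount (pairComplexity θ α x.1 x.2.2 x.2.1) x.2.2 x.2.1 (r :: h) := fun x _ =>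
      Nat.le_add_right _ _
    have h3 := Finset.sum_le_sum h2
    rcases le_or_gt ((h.length + 1 : ℕ) : ℝ) f with hft | hft
    · have h4 := badCount_eq_of_length_le θ f (r :: h) hft
      rw [h4, List.length_cons]
      have : (0 : ℝ) ≤ (∑ x ∈ complexityIndex θ k,
        chargeCount (pairComplexity θ α x.1 x.2.2 x.2.1) x.2.2 x.2.1 (r :: h) : ℕ) :=
        Nat.cast_nonneg _
      have : (0 : ℝ) ≤ level θ (lastSlots (r :: h)) := Nat.cast_nonneg _
      linarith
    · have hU := confident_of_lt hc hft
      have h4 : level θ (lastSlots h) ≤ level θ (lastSlots (r :: h)) := level_mono hθ hU hrun.1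
      by_cases hb : Bad θ f h
      · obtain ⟨L, hL, hr, hnr⟩ := exists_first_wrong (hb.resolve_left (not_le.2 hft))
        have h5 : badCount θ f (r :: h) = badCount θ f h + 1 :=
           badCount_cons_of_bad r hb
        rw [h5]
        rcases hrun.1.progress hθ hanti (by linarith) hU (by omega) hkn hr with hp | hp
        · have h6 : level θ (lastSlots h) < level θ (lastSlots (r :: h)) :=
            level_lt hθ hU hrun.1 (by omega) hnr hp
          have h7 : (level θ (lastSlots h) : ℝ) + 1 ≤ level θ (lastSlots (r :: h)) := by
            exact_mod_cast h6
          have h8 := (Nat.cast_le (α := ℝ)).2 h3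
          push_cast
          push_cast at h1 h8
          linarith
        · obtain ⟨i, j, hij, hi, hj, hjg, hcomp⟩ := hp
          have h6 := Finset.sum_lt_sum h2 ⟨⟨⟨L, by omega⟩, j, i⟩,
            mem_complexityIndex.2 ⟨by simp only; omega, hjg, hij⟩, by
              simp only [chargeCount]
              rw [if_pos ⟨hi, hj, hcomp⟩]
              exact Nat.lt_succ_self _⟩
          have h7 := (Nat.cast_le (α := ℝ)).2 (Nat.succ_le_of_lt h6)
          have h8 := (Nat.cast_le (α := ℝ)).2 h4
          push_cast
          push_cast at h1 h7
          linarith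
      · have h5 : badCount θ f (r :: h) = badCount θ f h :=
          badCount_cons_of_not_bad r hb
        have h8 := (Nat.cast_le (α := ℝ)).2 h3
        have h9 := (Nat.cast_le (α := ℝ)).2 h4
        rw [h5]
        push_cast
        push_cast at h1 h8
        linarith

include hθ hanti hα hk in
/-- The number of bad rounds, with room for one more round for each item that is not among the
best `k`. -/
theorem badCount_add_le (hgap : θ ⟨k, hkn⟩ < θ ⟨k - 1, pred_lt_of_lt hkn⟩) (hf : 0 ≤ f) {h : History n k}
    (hrun : IsRun α h) (hc : ConfidentAfter θ α f h) :
    (badCount θ f h : ℝ) + (n - k) ≤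
      2 * f + 2 * totalComplexity θ α k * Real.log (2 * totalComplexity θ α k) := by
  have hD := le_totalComplexity hθ hanti hα hk hkn hgap
  set D := totalComplexity θ α k with hDdef
  have hk' : (2 : ℝ) ≤ k := by exact_mod_cast hk
  have hn' : (k : ℝ) + 1 ≤ n := by exact_mod_cast hkn
  have hD0 : 0 < D := by linarith
  have hlog : 1 / 2 ≤ Real.log (2 * D) := by
    have h1 := Real.log_le_log (by norm_num : (0 : ℝ) < 2) (by linarith : 2 ≤ 2 * D)
    have h2 := Real.log_two_gt_d9
    linarith
  have hDlog : D ≤ 2 * D * Real.log (2 * D) := by nlinarith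
  have hshort : ∀ m : ℝ, m ≤ f → m + (n - k) ≤ 2 * f + 2 * D * Real.log (2 * D) := by
    intro m hm
    linarith
  induction h with
  | nil =>
    simp only [badCount, Nat.cast_zero]
    exact hshort 0 hf
  | cons r h ih =>
    rcases le_or_gt ((h.length + 1 : ℕ) : ℝ) f with hft | hft
    · rw [badCount_eq_of_length_le θ f (r :: h) hft]
      exact hshort _ hft
    · by_cases hb : Bad θ f h
      · have hlen : badCount θ f (r :: h) = h.length + 1 := by
          rw [badCount_cons_of_bad r hb,
            badCount_eq_length hθ hk hrun.2.2 hc.2 (hb.resolve_left (not_le.2 hft))]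
        have h1 := badCount_le hθ hanti hα hkn hf hrun hc
        rw [hlen] at h1 ⊢
        set m : ℕ := h.length + 1 with hm
        have hm0 : (0 : ℝ) < m := by exact_mod_cast Nat.succ_pos _
        have h2 : ((∑ x ∈ complexityIndex θ k,
            chargeCount (pairComplexity θ α x.1 x.2.2 x.2.1) x.2.2 x.2.1 (r :: h) : ℕ) : ℝ) ≤
            ∑ x ∈ complexityIndex θ k, (pairComplexity θ α x.1 x.2.2 x.2.1 * Real.log m
              + pairComplexity θ α x.1 x.2.2 x.2.1 / 8) := by
          push_cast
          refine Finset.sum_le_sum fun x hx => ?_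
          rw [mem_complexityIndex] at hx
          have h3 := eight_le_pairComplexity hθ hα (i := x.2.2) hx.2.1
          have h4 := chargeCount_le (D := pairComplexity θ α x.1 x.2.2 x.2.1) (by linarith)
            hx.2.2.ne hrun
          rw [List.length_cons] at h4
          linarith
        rw [Finset.sum_add_distrib, ← Finset.sum_mul, ← Finset.sum_div, ← totalComplexity_eq,
          ← hDdef] at h2
        have h5 : (level θ (lastSlots (r :: h)) : ℝ) ≤ k - 1 := by
          have := (Nat.cast_le (α := ℝ)).2 (level_le (θ := θ) (lastSlots (r :: h)))
          rwa [Nat.cast_sub (by omega), Nat.cast_one] at this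
        -- The tangent of the logarithm at `2 D` turns `m ≤ f + D ln m + …` into a bound on `m`.
        have h6 : D * Real.log m ≤ D * Real.log (2 * D) + m / 2 - D := by
          have h7 := Real.log_le_sub_one_of_pos (show 0 < (m : ℝ) / (2 * D) by positivity)
          rw [Real.log_div hm0.ne' (by positivity)] at h7
          have h8 := mul_le_mul_of_nonneg_left h7 hD0.le
          have h9 : D * (m / (2 * D)) = (m : ℝ) / 2 := by field_simp
          rw [mul_sub, mul_sub, h9] at h8
          linarith
        linarith
      · have h5 : badCount θ f (r :: h) = badCount θ f h :=
          badCount_cons_of_not_bad r hb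
        rw [h5]
        exact ih hrun.2.2 hc.2

end count

/-! ### Regret -/

section regret
variable {n k : ℕ} {θ : Fin n → ℝ} (hθ : ∀ i, 0 < θ i) (hanti : Antitone θ) {α f : ℝ}
  (hα : 1 / 2 < α) (hk : 2 ≤ k) (hkn : k < n)

theorem card_val_ge (m : ℕ) (hm : m ≤ n) :
    (Finset.univ.filter fun i : Fin n => m ≤ i.val).card = n - m := by
  have h1 := Finset.card_filter_add_card_filter_not (s := (Finset.univ : Finset (Fin n)))
    (fun i : Fin n => i.val < m)
  rw [Fin.card_filter_val_lt, min_eq_right hm, Finset.card_univ, Fintype.card_fin] at h1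
  simp only [not_lt] at h1
  omega

include hanti in
/-- No set of `k` items is worse than the last `k` items. -/
theorem sum_bottom_le {R : Finset (Fin n)} (hR : R.card = k) (hk0 : 0 < k) (hkn' : k ≤ n) :
    ∑ i : Fin n with n - k ≤ i.val, θ i ≤ ∑ i ∈ R, θ i := by
  set A := Finset.univ.filter fun i : Fin n => n - k ≤ i.val with hA
  have hAcard : A.card = R.card := by
    rw [hA, card_val_ge _ (Nat.sub_le n k), hR]
    omega
  rw [← Finset.sum_inter_add_sum_sdiff A R, ← Finset.sum_inter_add_sum_sdiff R A,
    Finset.inter_comm R A]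
  have h1 : ∑ i ∈ A \ R, θ i ≤ (A \ R).card • θ ⟨n - k, by omega⟩ := by
    refine Finset.sum_le_card_nsmul _ _ _ fun i hi => hanti ?_
    rw [Finset.mem_sdiff, hA, Finset.mem_filter] at hi
    exact hi.1.2
  have h2 : (R \ A).card • θ ⟨n - k, by omega⟩ ≤ ∑ i ∈ R \ A, θ i := by
    refine Finset.card_nsmul_le_sum _ _ _ fun i hi => hanti ?_
    rw [Finset.mem_sdiff, hA, Finset.mem_filter, not_and, not_le] at hi
    exact (hi.2 (Finset.mem_univ i)).le
  rw [Finset.card_sdiff_comm hAcard] at h1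
  linarith

include hanti in
theorem regret_le_maxRegret {R : Finset (Fin n)} (hR : R.card = k) (hk0 : 0 < k) (hkn' : k ≤ n) :
    (∑ i : Fin n with i.val < k, θ i - ∑ i ∈ R, θ i) / (k : ℝ) ≤ maxRegret θ k := by
  unfold maxRegret
  have := sum_bottom_le hanti hR hk0 hkn'
  gcongr

include hk hkn in
theorem sum_top_eq : ∑ i : Fin n with i.val < k, θ i =
    θ ⟨k - 1, pred_lt_of_lt hkn⟩ + ∑ i : Fin n with i.val < k - 1, θ i := by
  rw [← sum_val_lt_succ (L := k - 1) (by omega), Nat.sub_add_cancel (by omega)]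

include hanti hk hkn in
/-- Playing `b` in place of the item of rank `k` costs at most the maximal regret. -/
theorem gap_le_maxRegret {b : Fin n} (hb : k ≤ b.val) :
    (θ ⟨k - 1, pred_lt_of_lt hkn⟩ - θ b) / k ≤ maxRegret θ k := by
  have hbn : b ∉ Finset.univ.filter fun i : Fin n => i.val < k - 1 := by
    simp only [Finset.mem_filter, Finset.mem_univ, true_and]
    omega
  refine le_trans (le_of_eq ?_) (regret_le_maxRegret hanti (R := insert b
    (Finset.univ.filter fun i : Fin n => i.val < k - 1)) ?_ (by omega) hkn.le)
  · rw [sum_top_eq hk hkn, Finset.sum_insert hbn]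
    ring
  · rw [Finset.card_insert_of_notMem hbn, Fin.card_filter_val_lt]
    omega

theorem dHat_le (κ b : Fin n) {g : Fin n} (hg : g.val + 1 < k) :
    dHat θ k κ b ≤ pref θ κ g - pref θ b g :=
  ciInf_le (f := fun g : {g : Fin n // (g : ℕ) + 1 < k} => pref θ κ g - pref θ b g)
    (Set.finite_range _).bddBelow ⟨g, hg⟩

include hθ hanti hk hkn in
theorem dHat_ge {b : Fin n} (hb : θ b ≤ θ ⟨k - 1, pred_lt_of_lt hkn⟩) :
    (θ ⟨k - 1, pred_lt_of_lt hkn⟩ - θ b) / (4 * θ ⟨0, Nat.zero_lt_of_lt hkn⟩) ≤ dHat θ k ⟨k - 1, pred_lt_of_lt hkn⟩ b := by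
  have : Nonempty {g : Fin n // (g : ℕ) + 1 < k} := ⟨⟨⟨0, Nat.zero_lt_of_lt hkn⟩, by simp only; omega⟩⟩
  refine le_ciInf fun g => ?_
  obtain ⟨g, hg⟩ := g
  simp only
  set κ : Fin n := ⟨k - 1, pred_lt_of_lt hkn⟩ with hκ
  have hgκ : θ κ ≤ θ g := hanti (by rw [Fin.le_def]; simp only [hκ]; omega)
  have hg0 : θ g ≤ θ ⟨0, Nat.zero_lt_of_lt hkn⟩ := hanti (by rw [Fin.le_def]; simp)
  have h1 := hθ g
  have h2 := hθ κ
  have h3 := hθ b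
  have h4 : pref θ κ g - pref θ b g =
      θ g * (θ κ - θ b) / ((θ κ + θ g) * (θ b + θ g)) := by
    unfold pref
    rw [div_sub_div _ _ (by linarith) (by linarith)]
    congr 1
    ring
  have h5 : (θ κ - θ b) / (4 * θ g) = θ g * (θ κ - θ b) / ((2 * θ g) * (2 * θ g)) := by
    field_simp
    ring
  rw [h4]
  have h6 : 0 ≤ θ κ - θ b := by linarith
  calc (θ κ - θ b) / (4 * θ ⟨0, Nat.zero_lt_of_lt hkn⟩) ≤ (θ κ - θ b) / (4 * θ g) := by gcongr
    _ = θ g * (θ κ - θ b) / ((2 * θ g) * (2 * θ g)) := h5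
    _ ≤ _ := by
      apply div_le_div_of_nonneg_left (by positivity) (by positivity)
      apply mul_le_mul <;> linarith

include hθ hanti hα hk hkn in
/-- In the rounds that are not bad, the first `k - 1` slots hold the same items throughout, and all
of these items are played. -/
theorem saturatedCount_le_comps {h : History n k} (hrun : IsRun α h) (hc : ConfidentAfter θ α f h)
    (hr : RightUpTo θ (lastSlots h) (k - 1)) {b s : Fin n}
    (hs : s ∈ slotSet (lastSlots h) (k - 1)) (hbs : b ≠ s) :
    saturatedCount θ f b h ≤ comps h b s := by
  induction h with
  | nil => simp [saturatedCount]
  | cons r h ih =>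
    by_cases hb : Bad θ f h
    · rw [saturatedCount, saturatedCount_eq_zero hθ hk hrun.2.2 hc.2 b hb, if_neg fun h => h.1 hb]
      exact Nat.zero_le _
    · unfold Bad at hb
      rw [not_or, not_le, not_not] at hb
      have hU := confident_of_lt hc hb.1
      have hslots : slotSet r.slots (k - 1) = slotSet (lastSlots h) (k - 1) :=
        (hrun.1.rightUpTo hθ hU (by omega) hb.2).2
      have hs' : s ∈ slotSet (lastSlots h) (k - 1) := hslots ▸ hs
      have h1 := ih hrun.2.2 hc.2 hb.2 hs'
      obtain ⟨b', -, hR, -⟩ := hrun.1.saturated hθ hanti (by linarith) hU hk hkn hb.2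
      have hsR : s ∈ r.played := hR ▸ Finset.mem_insert_of_mem hs'
      rw [saturatedCount, comps_cons hrun.2.1 h hbs]
      split_ifs with h2 h3 h3
      · omega
      · exact absurd ⟨h2.2, hsR⟩ h3
      · omega
      · omega

include hθ hanti hα hk hkn in
/-- In the rounds that are not bad, an item `b` that is not among the best `k` is played at most
`4 α ln T / D̂_b² + 1` times. -/
theorem saturatedCount_le (hgap : θ ⟨k, hkn⟩ < θ ⟨k - 1, pred_lt_of_lt hkn⟩) {h : History n k}
    (hrun : IsRun α h) (hc : ConfidentAfter θ α f h) {b : Fin n} (hb : k ≤ b.val) :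
    (saturatedCount θ f b h : ℝ) ≤
      4 * α / (dHat θ k ⟨k - 1, pred_lt_of_lt hkn⟩ b) ^ 2 * Real.log h.length + 1 := by
  have hbκ : θ b < θ ⟨k - 1, pred_lt_of_lt hkn⟩ := (hanti (show ⟨k, hkn⟩ ≤ b from hb)).trans_lt hgap
  have hd : 0 < dHat θ k ⟨k - 1, pred_lt_of_lt hkn⟩ b :=
    lt_of_lt_of_le (div_pos (sub_pos.2 hbκ) (mul_pos (by norm_num) (hθ _)))
      (dHat_ge hθ hanti hk hkn hbκ.le)
  have hD : 0 ≤ 4 * α / (dHat θ k ⟨k - 1, pred_lt_of_lt hkn⟩ b) ^ 2 := by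
    have : 0 ≤ α := by linarith
    positivity
  induction h with
  | nil => simp [saturatedCount]
  | cons r h ih =>
    have h1 := mul_log_le_mul_log_succ hD h.length
    rw [saturatedCount, List.length_cons]
    split_ifs with hcond
    · obtain ⟨hbad, hbR⟩ := hcond
      unfold Bad at hbad
      rw [not_or, not_le, not_not] at hbad
      have hU := confident_of_lt hc hbad.1
      obtain ⟨b', hb'S, hR, hb'⟩ := hrun.1.saturated hθ hanti (by linarith) hU hk hkn hbad.2
      have hbS : b ∉ slotSet (lastSlots h) (k - 1) := by
        intro hbS
        obtain ⟨g, hg, hgb⟩ := hbad.2.theta_eq hanti hkn hbS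
        have h2 : θ ⟨k - 1, pred_lt_of_lt hkn⟩ ≤ θ g := hanti (show g.val ≤ k - 1 from hg.le)
        linarith
      obtain rfl : b = b' := (Finset.mem_insert.1 (hR ▸ hbR)).resolve_right hbS
      rcases hb' with he | ⟨-, s, hs, hcomp⟩
      · exact absurd he hbκ.ne
      · have hbs : b ≠ s := fun e => hbS (e ▸ hs)
        have h2 := saturatedCount_le_comps hθ hanti hα hk hkn hrun.2.2 hc.2 hbad.2 hs hbs
        obtain ⟨g, hg, hgs⟩ := hbad.2.theta_eq hanti hkn hs
        have h3 : dHat θ k ⟨k - 1, pred_lt_of_lt hkn⟩ b ≤ pref θ ⟨k - 1, pred_lt_of_lt hkn⟩ s - pref θ b s := by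
          rw [pref_congr (i := b) rfl hgs, pref_congr (i := ⟨k - 1, pred_lt_of_lt hkn⟩) rfl hgs]
          exact dHat_le _ b (by omega)
        have hL : 0 ≤ Real.log (h.length + 1 : ℕ) := Real.log_natCast_nonneg _
        have h4 : 4 * α / (pref θ ⟨k - 1, pred_lt_of_lt hkn⟩ s - pref θ b s) ^ 2
            * Real.log (h.length + 1 : ℕ) ≤
            4 * α / (dHat θ k ⟨k - 1, pred_lt_of_lt hkn⟩ b) ^ 2 * Real.log (h.length + 1 : ℕ) := by
          have : 0 ≤ α := by linarith
          gcongr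
        have h5 := (Nat.cast_le (α := ℝ)).2 h2
        rw [Nat.cast_add, Nat.cast_one]
        linarith
    · have h2 := ih hrun.2.2 hc.2
      rw [Nat.cast_add, Nat.cast_zero]
      linarith

include hθ hanti hα hk hkn in
/-- A bad round costs at most the maximal regret; any other round costs the gap of the one item
outside of the best `k` that is played, if there is one. -/
theorem topRegret_le (hgap : θ ⟨k, hkn⟩ < θ ⟨k - 1, pred_lt_of_lt hkn⟩) {h : History n k}
    (hrun : IsRun α h) (hc : ConfidentAfter θ α f h) :
    topRegret θ h ≤ badCount θ f h * maxRegret θ k + ∑ b : Fin n with k ≤ b.val,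
      saturatedCount θ f b h * ((θ ⟨k - 1, pred_lt_of_lt hkn⟩ - θ b) / k) := by
  classical
  have hpos : ∀ b ∈ Finset.univ.filter fun b : Fin n => k ≤ b.val,
      0 ≤ (θ ⟨k - 1, pred_lt_of_lt hkn⟩ - θ b) / k := fun b hb => by
    have h1 : θ b ≤ θ ⟨k, hkn⟩ := hanti (show ⟨k, hkn⟩ ≤ b from (Finset.mem_filter.1 hb).2)
    have h2 : 0 ≤ θ ⟨k - 1, pred_lt_of_lt hkn⟩ - θ b := by linarith
    positivity
  induction h with
  | nil => simp [topRegret, badCount, saturatedCount]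
  | cons r h ih =>
    have h1 := ih hrun.2.2 hc.2
    have h2 : topRegret θ (r :: h) =
        (∑ i : Fin n with i.val < k, θ i - ∑ i ∈ r.played, θ i) / (k : ℝ) + topRegret θ h := by
      simp [topRegret]
    rw [h2]
    have h3 : ∑ b : Fin n with k ≤ b.val,
        (saturatedCount θ f b (r :: h) : ℝ) * ((θ ⟨k - 1, pred_lt_of_lt hkn⟩ - θ b) / k) =
        ∑ b : Fin n with k ≤ b.val,
          (saturatedCount θ f b h : ℝ) * ((θ ⟨k - 1, pred_lt_of_lt hkn⟩ - θ b) / k) +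
        ∑ b : Fin n with k ≤ b.val,
          (if ¬ Bad θ f h ∧ b ∈ r.played then 1 else 0) * ((θ ⟨k - 1, pred_lt_of_lt hkn⟩ - θ b) / k) := by
      rw [← Finset.sum_add_distrib]
      refine Finset.sum_congr rfl fun b _ => ?_
      rw [saturatedCount, ← add_mul]
      push_cast
      rfl
    rw [h3]
    have hpos' : ∀ b ∈ Finset.univ.filter fun b : Fin n => k ≤ b.val,
        0 ≤ (if ¬ Bad θ f h ∧ b ∈ r.played then (1 : ℝ) else 0)
          * ((θ ⟨k - 1, pred_lt_of_lt hkn⟩ - θ b) / k) := fun b hb =>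
      mul_nonneg (by split_ifs <;> norm_num) (hpos b hb)
    by_cases hb : Bad θ f h
    · have h4 := regret_le_maxRegret hanti hrun.1.card (by omega) hkn.le
      have h5 := Finset.sum_nonneg hpos'
      rw [badCount_cons_of_bad r hb, Nat.cast_add, Nat.cast_one, add_mul, one_mul]
      linarith
    · rw [badCount_cons_of_not_bad r hb]
      suffices hs : (∑ i : Fin n with i.val < k, θ i - ∑ i ∈ r.played, θ i) / (k : ℝ) ≤
          ∑ b : Fin n with k ≤ b.val, (if ¬ Bad θ f h ∧ b ∈ r.played then (1 : ℝ) else 0)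
            * ((θ ⟨k - 1, pred_lt_of_lt hkn⟩ - θ b) / k) by linarith
      have hbad := hb
      unfold Bad at hbad
      rw [not_or, not_le, not_not] at hbad
      obtain ⟨b', hb'S, hR, hb'⟩ := hrun.1.saturated hθ hanti (by linarith)
        (confident_of_lt hc hbad.1) hk hkn hbad.2
      have h4 : (∑ i : Fin n with i.val < k, θ i - ∑ i ∈ r.played, θ i) / (k : ℝ) =
          (θ ⟨k - 1, pred_lt_of_lt hkn⟩ - θ b') / k := by
        rw [hR, Finset.sum_insert hb'S, hbad.2.sum hanti (by omega) hkn, sum_top_eq hk hkn]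
        congr 1
        ring
      rw [h4]
      rcases hb' with he | ⟨hlt, -⟩
      · rw [he, sub_self, zero_div]
        exact Finset.sum_nonneg hpos'
      · have hb'k : k ≤ b'.val := by
          have := Fin.lt_def.1 (lt_of_theta_lt hanti hlt)
          simp only at this
          omega
        refine le_trans (le_of_eq ?_) (Finset.single_le_sum hpos'
          (Finset.mem_filter.2 ⟨Finset.mem_univ b', hb'k⟩))
        rw [if_pos ⟨hb, hR ▸ Finset.mem_insert_self _ _⟩, one_mul]

include hθ hanti hα hk hkn in
theorem topRegret_le_of_confidentAfter (hgap : θ ⟨k, hkn⟩ < θ ⟨k - 1, pred_lt_of_lt hkn⟩) (hf : 0 ≤ f)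
    {h : History n k} (hrun : IsRun α h) (hc : ConfidentAfter θ α f h) :
    topRegret θ h ≤
      (2 * f + 2 * totalComplexity θ α k * Real.log (2 * totalComplexity θ α k)) * maxRegret θ k
        + saturationTerm θ α k ⟨k - 1, pred_lt_of_lt hkn⟩ h.length := by
  have hpos : ∀ b : Fin n, k ≤ b.val → 0 ≤ (θ ⟨k - 1, pred_lt_of_lt hkn⟩ - θ b) / k := fun b hb => by
    have h1 : θ b ≤ θ ⟨k, hkn⟩ := hanti (show ⟨k, hkn⟩ ≤ b from hb)
    have h2 : 0 ≤ θ ⟨k - 1, pred_lt_of_lt hkn⟩ - θ b := by linarith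
    positivity
  have h1 := topRegret_le hθ hanti hα hk hkn hgap hrun hc
  have h2 : ∑ b : Fin n with k ≤ b.val,
      (saturatedCount θ f b h : ℝ) * ((θ ⟨k - 1, pred_lt_of_lt hkn⟩ - θ b) / k) ≤
      ∑ b : Fin n with k ≤ b.val, (4 * α * Real.log h.length / (k : ℝ) *
        ((θ ⟨k - 1, pred_lt_of_lt hkn⟩ - θ b) / (dHat θ k ⟨k - 1, pred_lt_of_lt hkn⟩ b) ^ 2) + maxRegret θ k) := by
    refine Finset.sum_le_sum fun b hb => ?_
    have hb' : k ≤ b.val := (Finset.mem_filter.1 hb).2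
    have h3 := mul_le_mul_of_nonneg_right
      (saturatedCount_le hθ hanti hα hk hkn hgap hrun hc hb') (hpos b hb')
    rw [add_mul, one_mul] at h3
    refine h3.trans (add_le_add (le_of_eq ?_) (gap_le_maxRegret hanti hk hkn hb'))
    ring
  rw [Finset.sum_add_distrib, ← Finset.mul_sum, Finset.sum_const, card_val_ge k hkn.le,
    nsmul_eq_mul, Nat.cast_sub hkn.le] at h2
  have h0 : 0 ≤ maxRegret θ k :=
    (hpos ⟨k, hkn⟩ le_rfl).trans (gap_le_maxRegret hanti hk hkn le_rfl)
  have h4 := mul_le_mul_of_nonneg_right (badCount_add_le hθ hanti hα hk hkn hgap hf hrun hc) h0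
  rw [add_mul] at h4
  unfold saturationTerm
  linarith

include hθ hanti hα hk hkn in
theorem saturationTerm_le (hgap : θ ⟨k, hkn⟩ < θ ⟨k - 1, pred_lt_of_lt hkn⟩) (T : ℕ) :
    saturationTerm θ α k ⟨k - 1, pred_lt_of_lt hkn⟩ T ≤
      64 * α * (θ ⟨0, Nat.zero_lt_of_lt hkn⟩) ^ 2 * (((n : ℝ) - k) * Real.log T
        / (k * (θ ⟨k - 1, pred_lt_of_lt hkn⟩ - θ ⟨k, hkn⟩))) := by
  have hk0 : (0 : ℝ) < k := by exact_mod_cast (by omega : 0 < k)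
  have hL : 0 ≤ Real.log T := Real.log_natCast_nonneg _
  have hα0 : 0 < α := by linarith
  have h0 := hθ ⟨0, Nat.zero_lt_of_lt hkn⟩
  have hΔ : 0 < θ ⟨k - 1, pred_lt_of_lt hkn⟩ - θ ⟨k, hkn⟩ := sub_pos.2 hgap
  have h1 : ∑ b : Fin n with k ≤ b.val,
      (θ ⟨k - 1, pred_lt_of_lt hkn⟩ - θ b) / (dHat θ k ⟨k - 1, pred_lt_of_lt hkn⟩ b) ^ 2 ≤
      (Finset.univ.filter fun b : Fin n => k ≤ b.val).card •
        (16 * (θ ⟨0, Nat.zero_lt_of_lt hkn⟩) ^ 2 / (θ ⟨k - 1, pred_lt_of_lt hkn⟩ - θ ⟨k, hkn⟩)) := by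
    refine Finset.sum_le_card_nsmul _ _ _ fun b hb => ?_
    have hbk : θ b ≤ θ ⟨k, hkn⟩ := hanti (show ⟨k, hkn⟩ ≤ b from (Finset.mem_filter.1 hb).2)
    have hd := dHat_ge hθ hanti hk hkn (hbk.trans hgap.le)
    set x := θ ⟨k - 1, pred_lt_of_lt hkn⟩ - θ b with hx
    have hx0 : 0 < x := by linarith
    have hx1 : θ ⟨k - 1, pred_lt_of_lt hkn⟩ - θ ⟨k, hkn⟩ ≤ x := by linarith
    calc x / (dHat θ k ⟨k - 1, pred_lt_of_lt hkn⟩ b) ^ 2 ≤ x / (x / (4 * θ ⟨0, Nat.zero_lt_of_lt hkn⟩)) ^ 2 := by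
          gcongr
      _ = 16 * (θ ⟨0, Nat.zero_lt_of_lt hkn⟩) ^ 2 / x := by
          field_simp
          ring
      _ ≤ _ := by gcongr
  rw [card_val_ge k hkn.le, nsmul_eq_mul, Nat.cast_sub hkn.le] at h1
  unfold saturationTerm
  refine (mul_le_mul_of_nonneg_left h1 (by positivity)).trans (le_of_eq ?_)
  field_simp
  ring

end regret

theorem theorem6 (n k : ℕ) (hk : 2 ≤ k) (hkn : k < n)
    (θ : Fin n → ℝ) (hθ : ∀ i, 0 < θ i) (hanti : Antitone θ)
    (hgap : θ ⟨k, hkn⟩ < θ ⟨k - 1, by omega⟩)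
    (α : ℝ) (hα : 1 / 2 < α)
    (rule : Rule n k) (hrule : IsRecMaxMinUCB α rule)
    (T : ℕ) (δ : ℝ) (hδ₀ : 0 < δ) (hδ₁ : δ < 1) :
    ENNReal.ofReal (1 - δ) ≤
      (runLaw θ hθ rule T).toOuterMeasure
        {h | topRegret θ h ≤
          (2 * burnIn n α δ
            + 2 * totalComplexity θ α k * Real.log (2 * totalComplexity θ α k)) * maxRegret θ k
          + saturationTerm θ α k ⟨k - 1, by omega⟩ T} ∧
    saturationTerm θ α k ⟨k - 1, by omega⟩ T ≤
      64 * α * (θ ⟨0, by omega⟩) ^ 2 * (((n : ℝ) - k) * Real.log T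
        / (k * (θ ⟨k - 1, by omega⟩ - θ ⟨k, hkn⟩))) := by
  refine ⟨?_, saturationTerm_le hθ hanti hα hk hkn hgap T⟩
  have hn : 0 < n := by omega
  refine PMF.ofReal_one_sub_le _ _ _ hδ₀.le (runLaw_not_confidentAfter_le hn θ hθ rule
    (fun h m hm => (hrule h m hm).card.le) α δ hα hδ₀ T) fun h hh hc => ?_
  have h1 := topRegret_le_of_confidentAfter hθ hanti hα hk hkn hgap (burnIn_pos hn hα hδ₀).le
    (runLaw_isRun θ hθ hrule T h hh) (not_not.1 hc)
  rwa [runLaw_length θ hθ rule T h hh] at h1
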